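/- Let $q$ be a prime power. Work in the Bruck--Bose representation of $\mathrm{PG}(2,q^3)$ in $\mathrm{PG}(6,q)$: fix a basis of $\mathrm{GF}(q^3)$ over $\mathrm{GF}(q)$ (for instance $1,\tau,\tau^2$ with $\tau$ primitive), and let $\sigma(\alpha,\beta,z)\in \mathrm{GF}(q)^7$, for $\alpha,\beta\in\mathrm{GF}(q^3)$ and $z\in\mathrm{GF}(q)$, be the vector that consists of the coordinates of $\alpha$, the coordinates of $\beta$, and $z$. The affine point $(\alpha,\beta,1)$ of $\mathrm{PG}(2,q^3)$ corresponds to the point $\sigma(\alpha,\beta,1)$ of $\mathrm{PG}(6,q)$. A point $T=(\alpha,\beta,0)$ of the line $\ell_\infty: z=0$ corresponds to the plane $[T]=\{\sigma(\lambda\alpha,\lambda\beta,0):\lambda\in\mathrm{GF}(q^3)\}$ of the hyperplane $\Sigma_\infty: z=0$ of $\mathrm{PG}(6,q)$. These planes form a regular $2$-spread $\mathcal S$ of $\Sigma_\infty$. Its transversals are the lines $g$ of the extension of $\Sigma_\infty$ to $\mathrm{GF}(q^3)$ that are disjoint from $\mathrm{PG}(6,q)$ and for which the planes $\langle P,P^q,P^{q^2}\rangle\cap\mathrm{PG}(6,q)$,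 $P\in g$, are exactly the elements of $\mathcal S$; here $P^q$ is obtained by raising the coordinates of $P$ to the power $q$. A special conic of $[T]$ is a non-degenerate conic of the plane $[T]$ whose extension to $\mathrm{PG}(6,q^3)$ meets the transversals of $\mathcal S$. A special twisted cubic is a twisted cubic in a $3$-space of $\mathrm{PG}(6,q)$ that contains an element of $\mathcal S$ but is not contained in $\Sigma_\infty$, such that the extension of the cubic to $\mathrm{PG}(6,q^3)$ meets the transversals of $\mathcal S$. An order-$q$-subline of $\mathrm{PG}(2,q^3)$ is an image of $\mathrm{PG}(1,q)=\{(s,t,0): s,t\in\mathrm{GF}(q)\text{ not both }0\}$ under $\mathrm{PGL}(3,q^3)$. Let $\ell$ be an order-$q$-subline of $\mathrm{PG}(2,q^3)$ disjoint from $\ell_\infty$, and let $L$ be the point in which the line of $\mathrm{PG}(2,q^3)$ containing $\ell$ meets $\ell_\infty$. The points of $\ell$ correspond in $\mathrm{PG}(6,q)$ to the points of a special twisted cubic. Its shadow $\mathcal D$ is the set of points in which the tangent lines at its $q+1$ points meet $\Sigma_\infty$. Then $\mathcal D$ is a set of $q+1$ points of the plane $[L]$, and: 1. if $q$ is even, $\mathcal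 D$ is a special conic of $[L]$; 2. if $q$ is odd, no three distinct points of $\mathcal D$ lie on a common special conic of $[L]$. -/

import Mathlib

open scoped LinearAlgebra.Projectivization Matrix

namespace BruckBose

variable {F K : Type*} [Field F] [Field K] [Algebra F K]

/-! ### The plane `PG(2,q³)`, with `F = GF(q)` and `K = GF(q³)` -/

/-- The line at infinity `z = 0` of `PG(2,q³)`. -/
def lineAtInfinity (K : Type*) [Field K] : Set (ℙ K (Fin 3 → K)) :=
  {P | P.rep 2 = 0}

/-- The standard subline `PG(1,q) = {(s,t,0) : s,t ∈ GF(q) not both zero}` of `PG(2,q³)`. -/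
def standardSubline (F K : Type*) [Field F] [Field K] [Algebra F K] :
    Set (ℙ K (Fin 3 → K)) :=
  {P | ∃ (s t : F) (h : ![algebraMap F K s, algebraMap F K t, 0] ≠ 0),
    P = Projectivization.mk K ![algebraMap F K s, algebraMap F K t, 0] h}

/-- An order-`q`-subline of `PG(2,q³)` is an image of `PG(1,q)` under `PGL(3,q³)`. -/
def IsSubline (F : Type*) {K : Type*} [Field F] [Field K] [Algebra F K]
    (l : Set (ℙ K (Fin 3 → K))) : Prop :=
  ∃ g : (Fin 3 → K) ≃ₗ[K] (Fin 3 → K),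
    l = Projectivization.map (g : (Fin 3 → K) →ₗ[K] (Fin 3 → K)) g.injective ''
      standardSubline F K

/-! ### The Bruck-Bose map into `PG(6,q)` -/

/-- The generalised Bruck-Bose map `σ(α,β,z) = (a₀,a₁,a₂,b₀,b₁,b₂,z)`, where `aᵢ` and `bᵢ` are
the coordinates of `α` and `β` in a basis of `GF(q³)` over `GF(q)` (for instance `1, τ, τ²`). -/
noncomputable def sigma (b : Module.Basis (Fin 3) F K) : K × K × F →ₗ[F] (Fin 7 → F) where
  toFun p := ![b.repr p.1 0, b.repr p.1 1, b.repr p.1 2,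
    b.repr p.2.1 0, b.repr p.2.1 1, b.repr p.2.1 2, p.2.2]
  map_add' p r := by ext i; fin_cases i <;> simp
  map_smul' c p := by ext i; fin_cases i <;> simp

/-- The set `[X]` of affine points of `PG(6,q)` corresponding to the affine points `(α,β,1)` of a
set `X` of points of `PG(2,q³)`. -/
def affineImage (b : Module.Basis (Fin 3) F K) (X : Set (ℙ K (Fin 3 → K))) :
    Set (ℙ F (Fin 7 → F)) :=
  {Q | ∃ (α β : K) (h : ![α, β, 1] ≠ 0) (h' : sigma b (α, β, 1) ≠ 0),
    Projectivization.mk K ![α, β, 1] h ∈ X ∧ Q = Projectivization.mk F (sigma b (α, β, 1)) h'}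

/-- The hyperplane at infinity `Σ∞` of `PG(6,q)`, with equation `z = 0`. -/
def hyperplaneAtInfinity (F : Type*) [Field F] : Submodule F (Fin 7 → F) :=
  LinearMap.ker (LinearMap.proj (R := F) (φ := fun _ : Fin 7 => F) 6)

/-- The map `(α,β,z) ↦ σ(α,β,0)`, as a `GF(q)`-linear map on `GF(q³)³`. -/
noncomputable def sigmaInfinity (b : Module.Basis (Fin 3) F K) :
    (Fin 3 → K) →ₗ[F] (Fin 7 → F) where
  toFun v := sigma b (v 0, v 1, 0)
  map_add' v w := by rw [← map_add]; simp
  map_smul' c v := by rw [RingHom.id_apply, ← map_smul]; simp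

/-- The spread element `[T] = {σ(α,β,0) : (α,β,0) a vector of T}` of `PG(6,q)` corresponding to a
point `T` of the line at infinity. Projective subspaces are given as linear subspaces. -/
noncomputable def spreadElement (b : Module.Basis (Fin 3) F K) (T : ℙ K (Fin 3 → K)) :
    Submodule F (Fin 7 → F) :=
  (T.submodule.restrictScalars F).map (sigmaInfinity b)

/-- The regular `2`-spread `S` of `Σ∞`. -/
def spread (b : Module.Basis (Fin 3) F K) : Set (Submodule F (Fin 7 → F)) :=
  {W | ∃ T ∈ lineAtInfinity K, W = spreadElement b T}

/-! ### The cubic extension `PG(6,q³)` and the transversals of the spread -/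

/-- The embedding of `PG(6,q)` in `PG(6,q³)`, on vectors. -/
def embed (F K : Type*) [Field F] [Field K] [Algebra F K] : (Fin 7 → F) →ₗ[F] (Fin 7 → K) :=
  (Algebra.linearMap F K).compLeft (Fin 7)

/-- The extension `W*` of a subspace `W` of `PG(6,q)` to `PG(6,q³)`. -/
def extend (K : Type*) [Field K] [Algebra F K] (W : Submodule F (Fin 7 → F)) :
    Submodule K (Fin 7 → K) :=
  Submodule.span K (embed F K '' (W : Set (Fin 7 → F)))

/-- The subspace of `PG(6,q)` in which a subspace of `PG(6,q³)` meets `PG(6,q)`. -/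
def rationalPart (F : Type*) {K : Type*} [Field F] [Field K] [Algebra F K]
    (U : Submodule K (Fin 7 → K)) : Submodule F (Fin 7 → F) :=
  (U.restrictScalars F).comap (embed F K)

/-- Conjugation `x ↦ x^q` of `PG(6,q³)`, on vectors. -/
noncomputable def conj (F : Type*) {K : Type*} [Field K] (x : Fin 7 → K) : Fin 7 → K :=
  fun i => x i ^ Nat.card F

/-- `g` is a transversal line of the regular spread: a line of `Σ∞*` disjoint from `PG(6,q)` such
that the planes `⟨P, P^q, P^{q²}⟩ ∩ PG(6,q)`, for `P` on `g`, are exactly the spread elements. -/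
def IsTransversal (b : Module.Basis (Fin 3) F K) (g : Submodule K (Fin 7 → K)) : Prop :=
  Module.finrank K g = 2 ∧ g ≤ hyperplaneAtInfinity K ∧ rationalPart F g = ⊥ ∧
    {W | ∃ x ∈ g, x ≠ 0 ∧
      W = rationalPart F (Submodule.span K {x, conj F x, conj F (conj F x)})} = spread b

/-! ### Special conics -/

/-- The quadratic form `p` restricted to the plane `W` defines a non-degenerate conic: it has no
singular point (over a finite field a singular conic has a rational singular point). -/
def IsNondegenerateOn (p : MvPolynomial (Fin 7) F) (W : Submodule F (Fin 7 → F)) : Prop :=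
  p.IsHomogeneous 2 ∧ ∀ x ∈ W, p.eval x = 0 →
    (∀ y ∈ W, p.eval (x + y) = p.eval x + p.eval y) → x = 0

/-- The points of `PG(6,q)` in the subspace `W` on which the form `p` vanishes. -/
def zeroLocus (p : MvPolynomial (Fin 7) F) (W : Submodule F (Fin 7 → F)) :
    Set (ℙ F (Fin 7 → F)) :=
  {P | P.submodule ≤ W ∧ ∀ v ∈ P.submodule, p.eval v = 0}

/-- `C` is a special conic of the spread element `[T]`: a non-degenerate conic of the plane `[T]`
whose extension to `PG(6,q³)` meets the transversals of the spread. -/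
def IsSpecialConic (b : Module.Basis (Fin 3) F K) (T : ℙ K (Fin 3 → K))
    (C : Set (ℙ F (Fin 7 → F))) : Prop :=
  ∃ p : MvPolynomial (Fin 7) F, IsNondegenerateOn p (spreadElement b T) ∧
    C = zeroLocus p (spreadElement b T) ∧
    ∀ g, IsTransversal b g →
      ∃ x ∈ g, x ≠ 0 ∧ x ∈ extend K (spreadElement b T) ∧ p.aeval x = 0

/-! ### Special twisted cubics, tangents and the shadow -/

/-- The point `(s³, s²t, st², t³)` of the standard twisted cubic. -/
def cubicPoint {R : Type*} [CommRing R] (s t : R) : Fin 4 → R :=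
  ![s ^ 3, s ^ 2 * t, s * t ^ 2, t ^ 3]

/-- The partial derivative of `cubicPoint` with respect to `s`. -/
def cubicPointDs {R : Type*} [CommRing R] (s t : R) : Fin 4 → R :=
  ![3 * s ^ 2, 2 * s * t, t ^ 2, 0]

/-- The partial derivative of `cubicPoint` with respect to `t`. -/
def cubicPointDt {R : Type*} [CommRing R] (s t : R) : Fin 4 → R :=
  ![0, s ^ 2, 2 * s * t, 3 * t ^ 2]

/-- The points of the image in `PG(6,q)` of the standard twisted cubic under the matrix `M`. -/
def cubicPoints (M : Matrix (Fin 7) (Fin 4) F) : Set (ℙ F (Fin 7 → F)) :=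
  {P | ∃ (s t : F) (h : M *ᵥ cubicPoint s t ≠ 0),
    P = Projectivization.mk F (M *ᵥ cubicPoint s t) h}

/-- The tangent line to the twisted cubic given by `M` at its point with parameter `(s,t)`. The
point itself is listed since in characteristic `3` the partial derivatives alone span no line. -/
def tangentLine (M : Matrix (Fin 7) (Fin 4) F) (s t : F) : Submodule F (Fin 7 → F) :=
  Submodule.span F {M *ᵥ cubicPoint s t, M *ᵥ cubicPointDs s t, M *ᵥ cubicPointDt s t}

/-- The matrix `M` of rank `4` parametrises a special twisted cubic: the `3`-space spanned by the
cubic contains a spread element but is not contained in `Σ∞`, and the extension of the cubic to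
`PG(6,q³)` meets the transversals of the spread. -/
def IsSpecialTwistedCubic (b : Module.Basis (Fin 3) F K) (M : Matrix (Fin 7) (Fin 4) F) : Prop :=
  Function.Injective M.mulVec ∧
    (∃ W ∈ spread b, W ≤ LinearMap.range M.mulVecLin) ∧
    ¬ LinearMap.range M.mulVecLin ≤ hyperplaneAtInfinity F ∧
    ∀ g, IsTransversal b g →
      ∃ s t : K, (s ≠ 0 ∨ t ≠ 0) ∧ M.map (algebraMap F K) *ᵥ cubicPoint s t ∈ g

/-- The shadow of an order-`q`-subline `l` disjoint from the line at infinity: the points in which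
the tangents of the special twisted cubic with point set `[l]` meet `Σ∞`. -/
def shadow (b : Module.Basis (Fin 3) F K) (l : Set (ℙ K (Fin 3 → K))) :
    Set (ℙ F (Fin 7 → F)) :=
  {D | ∃ M : Matrix (Fin 7) (Fin 4) F, IsSpecialTwistedCubic b M ∧
    cubicPoints M = affineImage b l ∧
    ∃ s t : F, (s ≠ 0 ∨ t ≠ 0) ∧
      D.submodule ≤ tangentLine M s t ∧ D.submodule ≤ hyperplaneAtInfinity F}

end BruckBose

namespace BruckBose

/-! Write N and Tr for the norm and trace of K over F. Scaling third coordinates to 1 shows that the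
points of the subline are P + (t/δ)v, where δ = s - θt, (s:t) runs over PG(1,q) and L = [v]; being
disjoint from the line at infinity says that θ is not in F (`IsSubline.exists_hasAffineParam`).
Vectors of the 3-space joining P to [L] are pairs (z,κ) in F × K (`coneMap`). Clearing denominators
by N(δ) gives the cubic z = N(δ), κ = t δ^q δ^{q²}. Both partial derivatives of the Möbius function
t/δ are F-multiples of 1/δ², so the tangent meets Σ∞ in κ = 1/δ² (`IsNormalForm.tangentLine_inf`).
Hence the shadow is {1/(s - θt)²} up to F-scalars (`mem_shadow_iff`). Its points are distinct
because an element of K whose square lies in F lies in F.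

The definition of the shadow allows every special twisted cubic with the right points. If the
extension of such a cubic meets a transversal at parameter η, then z is a multiple of N(s - ηt) and
κ is divisible by the two conjugates of s - ηt (`IsSpecialTwistedCubic.exists_isNormalForm`); by
`exists_reparam` it has the same shadow. Conversely, the cubic above has to meet all transversals,
so these must be known: there are exactly three, conjugate to each other
(`isTransversal_transversal`, `IsTransversal.exists_eq`).

The transversals meet the extension of [L] in the three vertices of the coordinates (κ, κ^q,
κ^{q²}). A quadratic form vanishing there has no square terms (`exists_special_form`), so at κ = y⁻²
it becomes, after multiplication by N(y)², a linear form Λ evaluated at y². For q even, Tr(γ²y²) =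
Tr(γy)², and with γ = θ^q - θ^{q²} its zeros are the F-span of 1 and θ; as every κ is a square, the
conic is the shadow. For q odd, three shadow points give dδ₃ = xδ₁ + yδ₂ with d, x, y nonzero in F.
Squaring and applying Λ gives 2xyΛ(δ₁δ₂) = 0, so Λ vanishes at δ₁², δ₁δ₂ and δ₂². Since δ₂/δ₁ is not
in F, this forces Λ = 0, and the form vanishes on [L]. -/

/-! ### The Frobenius automorphism of the cubic extension -/

/-- The Frobenius map `x ↦ x^q` of `K` over `F = GF(q)`. -/
noncomputable def frob (F K : Type*) [Field F] [Finite F] [Field K] [Algebra F K] : K →ₐ[F] K :=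
  letI := Fintype.ofFinite F
  FiniteField.frobeniusAlgHom F K

/-- The power `φ^l` of the Frobenius map, for `l = 0, 1, 2`. -/
noncomputable def frobPow (F K : Type*) [Field F] [Finite F] [Field K] [Algebra F K]
    (l : Fin 3) : K →ₐ[F] K :=
  frob F K ^ (l : ℕ)

section Frobenius

variable {F K : Type*} [Field F] [Finite F] [Field K] [Algebra F K]

theorem frob_apply (x : K) : frob F K x = x ^ Nat.card F := by
  let _ := Fintype.ofFinite F
  rw [Nat.card_eq_fintype_card]
  simp only [frob, FiniteField.coe_frobeniusAlgHom]

@[simp] theorem frobPow_zero (x : K) : frobPow F K 0 x = x := by simp [frobPow]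

@[simp] theorem frobPow_one (x : K) : frobPow F K 1 x = frob F K x := by simp [frobPow]

@[simp] theorem frobPow_two (x : K) : frobPow F K 2 x = frob F K (frob F K x) := by
  simp [frobPow, pow_succ]

theorem frob_frob_frob (h3 : Module.finrank F K = 3) (x : K) :
    frob F K (frob F K (frob F K x)) = x := by
  have : Module.Finite F K := Module.finite_of_finrank_pos (by omega)
  have : Finite K := Module.finite_of_finite F
  let _ := Fintype.ofFinite K
  simp only [frob_apply, ← pow_mul]
  have h : Nat.card F * Nat.card F * Nat.card F = Fintype.card K := by
    rw [← Nat.card_eq_fintype_card, Module.natCard_eq_pow_finrank (K := F) (V := K), h3]; ring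
  rw [h, FiniteField.pow_card]

theorem frob_frobPow (h3 : Module.finrank F K = 3) (l : Fin 3) (x : K) :
    frob F K (frobPow F K l x) = frobPow F K (l + 1) x := by
  fin_cases l
  · simp
  · simp
  · simp [frob_frob_frob h3]

/-- The polynomial X^q - X has at most q roots in K, and the q elements of F already supply them. -/
theorem exists_algebraMap_eq_of_frob_eq {x : K} (hx : frob F K x = x) :
    ∃ a : F, algebraMap F K a = x := by
  let _ := Fintype.ofFinite F
  rw [frob_apply, Nat.card_eq_fintype_card] at hx
  classical
  by_contra! h
  have hq := Fintype.one_lt_card (α := F)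
  have hne : (Polynomial.X ^ Fintype.card F - Polynomial.X : Polynomial K) ≠ 0 :=
    FiniteField.X_pow_card_sub_X_ne_zero K hq
  have hdeg := FiniteField.X_pow_card_sub_X_natDegree_eq K hq
  have hsub : insert x (Finset.univ.image (algebraMap F K)) ⊆
      (Polynomial.X ^ Fintype.card F - Polynomial.X : Polynomial K).roots.toFinset := by
    intro y hy
    rw [Multiset.mem_toFinset, Polynomial.mem_roots hne, Polynomial.IsRoot.def]
    rw [Finset.mem_insert, Finset.mem_image] at hy
    rcases hy with rfl | ⟨a, -, rfl⟩
    · simp [hx]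
    · simp [← map_pow, FiniteField.pow_card]
  have h1 := (Finset.card_le_card hsub).trans (Multiset.toFinset_card_le _)
  have h2 := h1.trans (Polynomial.card_roots' _)
  rw [hdeg, Finset.card_insert_of_notMem (by simpa using h),
    Finset.card_image_of_injective _ (algebraMap F K).injective, Finset.card_univ] at h2
  omega

theorem frob_algebraMap (a : F) : frob F K (algebraMap F K a) = algebraMap F K a :=
  (frob F K).commutes a

theorem frob_ne {θ : K} (hθ : ∀ a : F, algebraMap F K a ≠ θ) : frob F K θ ≠ θ := fun h =>
  let ⟨a, ha⟩ := exists_algebraMap_eq_of_frob_eq h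
  hθ a ha

theorem frob_frob_ne (h3 : Module.finrank F K = 3) {θ : K} (hθ : ∀ a : F, algebraMap F K a ≠ θ) :
    frob F K (frob F K θ) ≠ θ := fun h => by
  have := frob_frob_frob h3 θ
  rw [h] at this
  exact frob_ne hθ this

theorem frob_frob_ne_frob {θ : K} (hθ : ∀ a : F, algebraMap F K a ≠ θ) :
    frob F K (frob F K θ) ≠ frob F K θ := fun h =>
  frob_ne hθ ((frob F K).injective h)

theorem frobPow_ne_frobPow (h3 : Module.finrank F K = 3) {θ : K}
    (hθ : ∀ a : F, algebraMap F K a ≠ θ) {l m : Fin 3} (hlm : l ≠ m) :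
    frobPow F K l θ ≠ frobPow F K m θ := by
  have h1 := frob_ne hθ
  have h2 := frob_frob_ne h3 hθ
  have h4 := frob_frob_ne_frob hθ
  fin_cases l <;> fin_cases m <;> simp_all [Ne.symm]

omit [Finite F] in
theorem exists_notMem_range_algebraMap (h3 : Module.finrank F K = 3) :
    ∃ θ : K, ∀ a : F, algebraMap F K a ≠ θ := by
  by_contra! h
  have h1 : Function.Bijective (algebraMap F K) :=
    ⟨(algebraMap F K).injective, fun x => h x⟩
  have := (LinearEquiv.ofBijective (Algebra.linearMap F K) h1).finrank_eq
  rw [Module.finrank_self, h3] at this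
  omega

theorem algebraMap_trace_eq (h3 : Module.finrank F K = 3) (x : K) :
    algebraMap F K (Algebra.trace F K x) = x + frob F K x + frob F K (frob F K x) := by
  have : Module.Finite F K := Module.finite_of_finrank_pos (by omega)
  have : Finite K := Module.finite_of_finite F
  rw [FiniteField.algebraMap_trace_eq_sum_pow, h3]
  simp [Finset.sum_range_succ, frob_apply, ← pow_mul, pow_two]

/-- A square root in `K` of an element of `F` lies in `F`, as `[K : F]` is odd. -/
theorem frob_eq_of_sq (h3 : Module.finrank F K = 3) {w : K} (hw : frob F K (w ^ 2) = w ^ 2) :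
    frob F K w = w := by
  rw [map_pow] at hw
  rcases sq_eq_sq_iff_eq_or_eq_neg.mp hw with h | h
  · exact h
  -- Here w^q = -w. Applying Frobenius three times gives -w, yet it is the identity, so -w = w.
  · have h1 := frob_frob_frob h3 w
    simp only [h, map_neg, neg_neg] at h1
    exact h.trans h1

/-- The Vandermonde argument for three conjugates: the characters `1, φ, φ²` are independent. -/
theorem eq_zero_of_conjugates (h3 : Module.finrank F K = 3) {θ : K}
    (hθ : ∀ a : F, algebraMap F K a ≠ θ) {A B C : K} (h0 : A + B + C = 0)
    (h1 : A * θ + B * frob F K θ + C * frob F K (frob F K θ) = 0)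
    (h2 : A * θ ^ 2 + B * frob F K θ ^ 2 + C * frob F K (frob F K θ) ^ 2 = 0) :
    A = 0 ∧ B = 0 ∧ C = 0 := by
  have e1 := sub_ne_zero.mpr (frob_ne hθ)
  have e2 := sub_ne_zero.mpr (frob_frob_ne h3 hθ)
  have e3 := sub_ne_zero.mpr (frob_frob_ne_frob hθ)
  set p := frob F K θ
  set r := frob F K p
  -- The multipliers are the coefficients of -(X - θ)(X - r), which kills the terms in A and C; `hC`
  -- uses (X - θ)(X - p) in the same way.
  have hB : B * ((p - θ) * (r - p)) = 0 := by
    linear_combination (-θ * r) * h0 + (θ + r) * h1 - h2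
  have hC : C * ((r - θ) * (r - p)) = 0 := by
    linear_combination (θ * p) * h0 - (θ + p) * h1 + h2
  have hB0 := (mul_eq_zero.mp hB).resolve_right (mul_ne_zero e1 e3)
  have hC0 := (mul_eq_zero.mp hC).resolve_right (mul_ne_zero e2 e3)
  exact ⟨by linear_combination h0 - hB0 - hC0, hB0, hC0⟩

/-- If `Tr(γ y) = 0` for `γ = θ^q - θ^{q²}`, then `y` is in the `F`-span of `1` and `θ`. -/
theorem exists_eq_of_trace_eq_zero {θ y : K}
    (hθ : ∀ a : F, algebraMap F K a ≠ θ)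
    (h : y * (frob F K θ - frob F K (frob F K θ)) +
      frob F K y * (frob F K (frob F K θ) - θ) +
      frob F K (frob F K y) * (θ - frob F K θ) = 0) :
    ∃ s t : F, y = algebraMap F K s - θ * algebraMap F K t := by
  have e1 := sub_ne_zero.mpr (frob_ne hθ)
  have e3 := sub_ne_zero.mpr (frob_frob_ne_frob hθ)
  -- If y = s - θt, then y^q - y = -t(θ^q - θ). The hypothesis says exactly that the value of t so
  -- determined is fixed by Frobenius.
  obtain ⟨t, ht⟩ := exists_algebraMap_eq_of_frob_eq (F := F)
    (x := -(frob F K y - y) / (frob F K θ - θ)) (by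
      simp only [map_div₀, map_neg, map_sub]
      rw [div_eq_div_iff e3 e1]
      linear_combination h)
  obtain ⟨s, hs⟩ := exists_algebraMap_eq_of_frob_eq (F := F)
    (x := y + θ * algebraMap F K t) (by
      rw [map_add, map_mul, frob_algebraMap]
      rw [eq_div_iff e1] at ht
      linear_combination ht)
  exact ⟨s, t, by rw [hs]; ring⟩

end Frobenius

/-! ### Trace-dual bases -/

section Basis

variable {F K : Type*} [Field F] [Finite F] [Field K] [Algebra F K]

omit [Finite F] in
theorem finrank_eq_three (b : Module.Basis (Fin 3) F K) : Module.finrank F K = 3 := by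
  simp [Module.finrank_eq_card_basis b]

/-- The trace-dual of a basis gives the inverse of the matrix `φ^l(b_i)`. -/
theorem exists_dual_basis (b : Module.Basis (Fin 3) F K) :
    ∃ ε : Fin 3 → K,
      (∀ l m, frobPow F K l (b 0) * frobPow F K m (ε 0) + frobPow F K l (b 1) * frobPow F K m (ε 1)
        + frobPow F K l (b 2) * frobPow F K m (ε 2) = if l = m then 1 else 0) ∧
      (∀ i j, b i * ε j + frob F K (b i) * frob F K (ε j)
        + frob F K (frob F K (b i)) * frob F K (frob F K (ε j)) = if i = j then 1 else 0) := by
  have h3 := finrank_eq_three b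
  have : Module.Finite F K := Module.Finite.of_basis b
  let ε := (Algebra.traceForm F K).dualBasis (traceForm_nondegenerate F K) b
  have hε : ∀ i j, b i * ε j + frob F K (b i) * frob F K (ε j)
        + frob F K (frob F K (b i)) * frob F K (frob F K (ε j)) = if i = j then 1 else 0 := by
    intro i j
    have h1 : Algebra.trace F K (b i * ε j) = if i = j then 1 else 0 := by
      rw [mul_comm]
      have h2 := LinearMap.BilinForm.apply_dualBasis_left (B := Algebra.traceForm F K)
        (traceForm_nondegenerate F K) b j i
      simpa [Algebra.traceForm_apply, eq_comm] using h2
    have h2 := algebraMap_trace_eq h3 (b i * ε j)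
    rw [h1] at h2
    simp only [map_mul] at h2
    rw [← h2]
    split_ifs <;> simp
  refine ⟨ε, ?_, hε⟩
  let B : Matrix (Fin 3) (Fin 3) K := Matrix.of fun i l => frobPow F K l (b i)
  let E : Matrix (Fin 3) (Fin 3) K := Matrix.of fun m j => frobPow F K m (ε j)
  have hBE : B * E = 1 := by
    ext i j
    rw [Matrix.mul_apply, Fin.sum_univ_three, Matrix.one_apply, ← hε i j]
    simp [B, E]
  -- A one-sided inverse of a square matrix is two-sided; this turns orthogonality over conjugates
  -- into orthogonality over basis elements.
  have hEB : E * B = 1 := mul_eq_one_comm.mp hBE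
  intro l m
  have h1 := congrFun (congrFun hEB m) l
  rw [Matrix.mul_apply, Fin.sum_univ_three, Matrix.one_apply] at h1
  simp only [B, E, Matrix.of_apply] at h1
  simp only [eq_comm (a := m)] at h1
  linear_combination h1

/-- The trace-dual basis of a basis of `K` over `F`. -/
noncomputable def dualElt (b : Module.Basis (Fin 3) F K) : Fin 3 → K :=
  (exists_dual_basis b).choose

theorem sum_frobPow_mul_dualElt (b : Module.Basis (Fin 3) F K) (l m : Fin 3) :
    frobPow F K l (b 0) * frobPow F K m (dualElt b 0) +
      frobPow F K l (b 1) * frobPow F K m (dualElt b 1) +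
      frobPow F K l (b 2) * frobPow F K m (dualElt b 2) = if l = m then 1 else 0 :=
  (exists_dual_basis b).choose_spec.1 l m

theorem trace_mul_dualElt (b : Module.Basis (Fin 3) F K) (i j : Fin 3) :
    b i * dualElt b j + frob F K (b i) * frob F K (dualElt b j)
      + frob F K (frob F K (b i)) * frob F K (frob F K (dualElt b j)) = if i = j then 1 else 0 :=
  (exists_dual_basis b).choose_spec.2 i j

end Basis

/-! ### Coordinates of `PG(6,q³)` adapted to the transversals -/

section Coordinates

variable {F K : Type*} [Field F] [Finite F] [Field K] [Algebra F K]

/-- The `K`-linear extension of `σ(α,β,z) ↦ φ^l(α)`. -/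
noncomputable def coordX (b : Module.Basis (Fin 3) F K) (l : Fin 3) : (Fin 7 → K) →ₗ[K] K where
  toFun x := x 0 * frobPow F K l (b 0) + x 1 * frobPow F K l (b 1) + x 2 * frobPow F K l (b 2)
  map_add' x y := by simp only [Pi.add_apply]; ring
  map_smul' c x := by simp only [Pi.smul_apply, smul_eq_mul, RingHom.id_apply]; ring

/-- The `K`-linear extension of `σ(α,β,z) ↦ φ^l(β)`. -/
noncomputable def coordY (b : Module.Basis (Fin 3) F K) (l : Fin 3) : (Fin 7 → K) →ₗ[K] K where
  toFun x := x 3 * frobPow F K l (b 0) + x 4 * frobPow F K l (b 1) + x 5 * frobPow F K l (b 2)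
  map_add' x y := by simp only [Pi.add_apply]; ring
  map_smul' c x := by simp only [Pi.smul_apply, smul_eq_mul, RingHom.id_apply]; ring

theorem coordX_apply (b : Module.Basis (Fin 3) F K) (l : Fin 3) (x : Fin 7 → K) :
    coordX b l x =
      x 0 * frobPow F K l (b 0) + x 1 * frobPow F K l (b 1) + x 2 * frobPow F K l (b 2) := rfl

theorem coordY_apply (b : Module.Basis (Fin 3) F K) (l : Fin 3) (x : Fin 7 → K) :
    coordY b l x =
      x 3 * frobPow F K l (b 0) + x 4 * frobPow F K l (b 1) + x 5 * frobPow F K l (b 2) := rfl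

/-- The vector of `Σ∞` over `K` whose only nonzero coordinates are `α` and `β`, in place `l`. -/
noncomputable def transversalVec (b : Module.Basis (Fin 3) F K) (l : Fin 3) :
    K × K →ₗ[K] (Fin 7 → K) where
  toFun p := ![frobPow F K l (dualElt b 0) * p.1, frobPow F K l (dualElt b 1) * p.1,
    frobPow F K l (dualElt b 2) * p.1, frobPow F K l (dualElt b 0) * p.2,
    frobPow F K l (dualElt b 1) * p.2, frobPow F K l (dualElt b 2) * p.2, 0]
  map_add' x y := by ext i; fin_cases i <;> simp [mul_add]
  map_smul' c x := by ext i; fin_cases i <;> simp [mul_left_comm]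

theorem transversalVec_apply (b : Module.Basis (Fin 3) F K) (l : Fin 3) (p : K × K) :
    transversalVec b l p = ![frobPow F K l (dualElt b 0) * p.1, frobPow F K l (dualElt b 1) * p.1,
      frobPow F K l (dualElt b 2) * p.1, frobPow F K l (dualElt b 0) * p.2,
      frobPow F K l (dualElt b 1) * p.2, frobPow F K l (dualElt b 2) * p.2, 0] := rfl

@[simp] theorem transversalVec_six (b : Module.Basis (Fin 3) F K) (l : Fin 3) (p : K × K) :
    transversalVec b l p 6 = 0 := rfl

theorem coordX_transversalVec (b : Module.Basis (Fin 3) F K) (l m : Fin 3) (p : K × K) :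
    coordX b l (transversalVec b m p) = if l = m then p.1 else 0 := by
  have h := sum_frobPow_mul_dualElt b l m
  have h2 : coordX b l (transversalVec b m p) = (if l = m then 1 else 0) * p.1 := by
    rw [← h, coordX_apply, transversalVec_apply]
    simp only [Matrix.cons_val]
    ring
  rw [h2, ite_mul, one_mul, zero_mul]

theorem coordY_transversalVec (b : Module.Basis (Fin 3) F K) (l m : Fin 3) (p : K × K) :
    coordY b l (transversalVec b m p) = if l = m then p.2 else 0 := by
  have h := sum_frobPow_mul_dualElt b l m
  have h2 : coordY b l (transversalVec b m p) = (if l = m then 1 else 0) * p.2 := by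
    rw [← h, coordY_apply, transversalVec_apply]
    simp only [Matrix.cons_val]
    ring
  rw [h2, ite_mul, one_mul, zero_mul]

/-- The conjugate matrix of the basis is inverted by that of the dual basis, so `coordX`, `coordY`
and the last entry together are coordinates on K⁷. Later identities of vectors are checked in them.
-/
theorem eq_zero_of_coord (b : Module.Basis (Fin 3) F K) {x : Fin 7 → K} (h6 : x 6 = 0)
    (hX : ∀ l, coordX b l x = 0) (hY : ∀ l, coordY b l x = 0) : x = 0 := by
  have key : ∀ u : Fin 3 → K, (∀ l, u 0 * frobPow F K l (b 0) + u 1 * frobPow F K l (b 1) +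
      u 2 * frobPow F K l (b 2) = 0) → ∀ j, u j = 0 := by
    intro u hu j
    have e : ∀ i, b i * dualElt b j + frob F K (b i) * frob F K (dualElt b j)
      + frob F K (frob F K (b i)) * frob F K (frob F K (dualElt b j)) = if i = j then 1 else 0 :=
      fun i => trace_mul_dualElt b i j
    have h0 := hu 0
    have h1 := hu 1
    have h2 := hu 2
    simp only [frobPow_zero, frobPow_one, frobPow_two] at h0 h1 h2
    have : u 0 * (if 0 = j then 1 else 0) + u 1 * (if 1 = j then 1 else 0)
        + u 2 * (if 2 = j then 1 else 0) = 0 := by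
      rw [← e 0, ← e 1, ← e 2]
      linear_combination dualElt b j * h0 + frob F K (dualElt b j) * h1 +
        frob F K (frob F K (dualElt b j)) * h2
    fin_cases j <;> simpa using this
  have k1 := key ![x 0, x 1, x 2] (fun l => by simpa [coordX_apply] using hX l)
  have k2 := key ![x 3, x 4, x 5] (fun l => by simpa [coordY_apply] using hY l)
  ext i
  fin_cases i
  · exact k1 0
  · exact k1 1
  · exact k1 2
  · exact k2 0
  · exact k2 1
  · exact k2 2
  · exact h6

theorem eq_of_coord (b : Module.Basis (Fin 3) F K) {x y : Fin 7 → K} (h6 : x 6 = y 6)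
    (hX : ∀ l, coordX b l x = coordX b l y) (hY : ∀ l, coordY b l x = coordY b l y) : x = y := by
  rw [← sub_eq_zero]
  apply eq_zero_of_coord b
  · simp [h6]
  · intro l; rw [map_sub, hX, sub_self]
  · intro l; rw [map_sub, hY, sub_self]

omit [Finite F] in
@[simp] theorem sigma_six (b : Module.Basis (Fin 3) F K) (p : K × K × F) :
    sigma b p 6 = p.2.2 := rfl

omit [Finite F] in
@[simp] theorem embed_apply (x : Fin 7 → F) (i : Fin 7) :
    embed F K x i = algebraMap F K (x i) := rfl

/-- In the adapted coordinates a rational vector shows up as the conjugates of a single element of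
K. -/
theorem coordX_embed_sigma (b : Module.Basis (Fin 3) F K) (l : Fin 3) (p : K × K × F) :
    coordX b l (embed F K (sigma b p)) = frobPow F K l p.1 := by
  conv_rhs => rw [← b.sum_repr p.1]
  simp [coordX_apply, sigma, Fin.sum_univ_three, Algebra.smul_def]

theorem coordY_embed_sigma (b : Module.Basis (Fin 3) F K) (l : Fin 3) (p : K × K × F) :
    coordY b l (embed F K (sigma b p)) = frobPow F K l p.2.1 := by
  conv_rhs => rw [← b.sum_repr p.2.1]
  simp [coordY_apply, sigma, Fin.sum_univ_three, Algebra.smul_def]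

omit [Finite F] in
theorem sigma_surjective (b : Module.Basis (Fin 3) F K) (y : Fin 7 → F) :
    ∃ α β, sigma b (α, β, y 6) = y := by
  refine ⟨b.repr.symm (Finsupp.equivFunOnFinite.symm ![y 0, y 1, y 2]),
    b.repr.symm (Finsupp.equivFunOnFinite.symm ![y 3, y 4, y 5]), ?_⟩
  ext i
  fin_cases i <;> simp [sigma]

omit [Finite F] in
theorem sigma_injective (b : Module.Basis (Fin 3) F K) : Function.Injective (sigma b) := by
  rw [← LinearMap.ker_eq_bot, LinearMap.ker_eq_bot']
  rintro ⟨α, β, z⟩ h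
  have h' : ∀ i, sigma b (α, β, z) i = 0 := fun i => by rw [h]; rfl
  have hα : b.repr α = 0 := by
    ext i
    fin_cases i
    · exact h' 0
    · exact h' 1
    · exact h' 2
  have hβ : b.repr β = 0 := by
    ext i
    fin_cases i
    · exact h' 3
    · exact h' 4
    · exact h' 5
  have hz : z = 0 := h' 6
  simp only [map_eq_zero_iff _ b.repr.injective] at hα hβ
  rw [hα, hβ, hz]; rfl

theorem conj_apply (x : Fin 7 → K) (i : Fin 7) : conj F x i = frob F K (x i) :=
  (frob_apply (x i)).symm

/-- Conjugation permutes the three transversals cyclically. -/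
theorem conj_transversalVec (b : Module.Basis (Fin 3) F K) (l : Fin 3) (p : K × K) :
    conj F (transversalVec b l p) = transversalVec b (l + 1) (frob F K p.1, frob F K p.2) := by
  ext i
  rw [conj_apply, transversalVec_apply, transversalVec_apply]
  fin_cases i <;> simp [frob_frobPow (finrank_eq_three b)]

/-- A vector fixed by conjugation is rational. -/
theorem exists_embed_eq_of_conj_eq {x : Fin 7 → K} (hx : conj F x = x) :
    ∃ y, embed F K y = x := by
  have h : ∀ i, ∃ a : F, algebraMap F K a = x i := fun i =>
    exists_algebraMap_eq_of_frob_eq (by rw [← conj_apply, hx])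
  choose y hy using h
  exact ⟨y, funext hy⟩

theorem conj_add (x y : Fin 7 → K) : conj F (x + y) = conj F x + conj F y := by
  ext i; simp [conj_apply]

theorem conj_smul (c : K) (x : Fin 7 → K) : conj F (c • x) = frob F K c • conj F x := by
  ext i; simp [conj_apply]

theorem conj_conj_conj (h3 : Module.finrank F K = 3) (x : Fin 7 → K) :
    conj F (conj F (conj F x)) = x := by
  ext i; simp [conj_apply, frob_frob_frob h3]

end Coordinates

/-! ### The transversals of the spread -/

section Transversals

variable {F K : Type*} [Field F] [Finite F] [Field K] [Algebra F K]

/-- The three transversals of the spread. -/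
noncomputable def transversal (b : Module.Basis (Fin 3) F K) (l : Fin 3) :
    Submodule K (Fin 7 → K) :=
  LinearMap.range (transversalVec b l)

theorem mem_transversal_iff (b : Module.Basis (Fin 3) F K) (l : Fin 3) (x : Fin 7 → K) :
    x ∈ transversal b l ↔ x 6 = 0 ∧ ∀ m, m ≠ l → coordX b m x = 0 ∧ coordY b m x = 0 := by
  constructor
  · rintro ⟨p, rfl⟩
    refine ⟨rfl, fun m hm => ?_⟩
    rw [coordX_transversalVec, coordY_transversalVec, if_neg hm, if_neg hm]
    exact ⟨rfl, rfl⟩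
  · rintro ⟨h6, h⟩
    refine ⟨(coordX b l x, coordY b l x), eq_of_coord b (by simp [h6]) ?_ ?_⟩
    · intro m
      rw [coordX_transversalVec]
      split_ifs with hm
      · rw [hm]
      · exact (h m hm).1.symm
    · intro m
      rw [coordY_transversalVec]
      split_ifs with hm
      · rw [hm]
      · exact (h m hm).2.symm

theorem transversalVec_injective (b : Module.Basis (Fin 3) F K) (l : Fin 3) :
    Function.Injective (transversalVec b l) := by
  intro p r h
  have h1 := congrArg (coordX b l) h
  have h2 := congrArg (coordY b l) h
  rw [coordX_transversalVec, coordX_transversalVec, if_pos rfl, if_pos rfl] at h1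
  rw [coordY_transversalVec, coordY_transversalVec, if_pos rfl, if_pos rfl] at h2
  exact Prod.ext h1 h2

theorem finrank_transversal (b : Module.Basis (Fin 3) F K) (l : Fin 3) :
    Module.finrank K (transversal b l) = 2 := by
  rw [transversal, LinearMap.finrank_range_of_inj (transversalVec_injective b l)]
  simp

omit [Finite F] in
theorem mem_spreadElement_mk (b : Module.Basis (Fin 3) F K) {v : Fin 3 → K} (hv : v ≠ 0)
    (x : Fin 7 → F) :
    x ∈ spreadElement b (Projectivization.mk K v hv) ↔
      ∃ c : K, sigma b (c * v 0, c * v 1, 0) = x := by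
  simp only [spreadElement, Submodule.mem_map, Submodule.restrictScalars_mem,
    Projectivization.submodule_mk, Submodule.mem_span_singleton]
  constructor
  · rintro ⟨y, ⟨c, rfl⟩, rfl⟩
    exact ⟨c, rfl⟩
  · rintro ⟨c, rfl⟩
    exact ⟨c • v, ⟨c, rfl⟩, rfl⟩

omit [Finite F] in
theorem mk_mem_lineAtInfinity {v : Fin 3 → K} (hv : v ≠ 0) :
    Projectivization.mk K v hv ∈ lineAtInfinity K ↔ v 2 = 0 := by
  obtain ⟨a, ha⟩ := Projectivization.exists_smul_eq_mk_rep K v hv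
  simp only [lineAtInfinity, Set.mem_ofPred_eq, ← ha]
  simp [Units.smul_def]

omit [Finite F] in
-- This removes projective points from the definition of the spread; only the direction (α, β)
-- matters.
theorem mem_spread_iff (b : Module.Basis (Fin 3) F K) (W : Submodule F (Fin 7 → F)) :
    W ∈ spread b ↔ ∃ α β : K, (α, β) ≠ 0 ∧ ∀ x, x ∈ W ↔ ∃ c, sigma b (c * α, c * β, 0) = x := by
  constructor
  · rintro ⟨T, hT, rfl⟩
    induction T using Projectivization.ind with
    | h v hv =>
      rw [mk_mem_lineAtInfinity] at hT
      refine ⟨v 0, v 1, fun h => hv ?_, fun x => mem_spreadElement_mk b hv x⟩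
      rw [Prod.mk_eq_zero] at h
      ext i
      fin_cases i
      · exact h.1
      · exact h.2
      · exact hT
  · rintro ⟨α, β, h, hW⟩
    have hv : ![α, β, 0] ≠ 0 := fun h0 => h (by
      have h1 := congrFun h0 0
      have h2 := congrFun h0 1
      simp at h1 h2
      simp [h1, h2])
    refine ⟨Projectivization.mk K _ hv, ?_, ?_⟩
    · rw [mk_mem_lineAtInfinity]; rfl
    · ext x
      rw [hW, mem_spreadElement_mk]
      rfl

/-- The plane spanned by a point of a transversal and its conjugates meets `PG(6,q)` in a
spread element. -/
theorem mem_rationalPart_transversalVec (b : Module.Basis (Fin 3) F K) (l : Fin 3) (α β : K)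
    (y : Fin 7 → F) :
    let x := transversalVec b l (frobPow F K l α, frobPow F K l β)
    y ∈ rationalPart F (Submodule.span K {x, conj F x, conj F (conj F x)}) ↔
      ∃ c, sigma b (c * α, c * β, 0) = y := by
  intro x
  have h3 := finrank_eq_three b
  let e : Fin 3 → (Fin 7 → K) := fun m => transversalVec b m (frobPow F K m α, frobPow F K m β)
  -- The three conjugates are the vectors `e m` in cyclic order starting at l, so the plane does not
  -- depend on l.
  have hspan : Submodule.span K {x, conj F x, conj F (conj F x)} =
      Submodule.span K {e 0, e 1, e 2} := by
    have hx : ∀ m, conj F (e m) = e (m + 1) := fun m => by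
      simp only [e, conj_transversalVec, frob_frobPow h3]
    have h1 : conj F x = e (l + 1) := hx l
    rw [h1, hx]
    change Submodule.span K {e l, _, _} = _
    congr 1
    fin_cases l
    · rfl
    · ext z
      simp
      tauto
    · ext z
      simp
      tauto
  rw [hspan]
  simp only [rationalPart, Submodule.mem_comap, Submodule.restrictScalars_mem,
    Submodule.mem_span_triple]
  obtain ⟨α', β', hy⟩ := sigma_surjective b y
  constructor
  · rintro ⟨c0, c1, c2, h⟩
    -- Place 0 of the coordinates reads off α' = c0 α and β' = c0 β, which already determine a
    -- rational vector at infinity.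
    refine ⟨c0, ?_⟩
    have h6 := congrFun h 6
    have hX := congrArg (coordX b 0) h
    have hY := congrArg (coordY b 0) h
    rw [← hy] at hX hY
    rw [coordX_embed_sigma] at hX
    rw [coordY_embed_sigma] at hY
    simp only [e, map_add, map_smul, coordX_transversalVec, coordY_transversalVec] at hX hY
    simp [e] at h6 hX hY
    rw [eq_comm, map_eq_zero] at h6
    rw [hX, hY, ← h6, hy]
  · rintro ⟨c, rfl⟩
    refine ⟨c, frob F K c, frob F K (frob F K c), eq_of_coord b ?_ ?_ ?_⟩
    · simp [e]
    · intro m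
      rw [coordX_embed_sigma]
      simp only [e, map_add, map_smul, coordX_transversalVec]
      fin_cases m <;> simp
    · intro m
      rw [coordY_embed_sigma]
      simp only [e, map_add, map_smul, coordY_transversalVec]
      fin_cases m <;> simp

theorem frobPow_bijective (h3 : Module.finrank F K = 3) (l : Fin 3) :
    Function.Bijective (frobPow F K l) := by
  refine ⟨(frobPow F K l).injective, fun x => ?_⟩
  fin_cases l
  · exact ⟨x, by simp⟩
  · exact ⟨frob F K (frob F K x), by simp [frob_frob_frob h3]⟩
  · exact ⟨frob F K x, by simp [frob_frob_frob h3]⟩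

theorem isTransversal_transversal (b : Module.Basis (Fin 3) F K) (l : Fin 3) :
    IsTransversal b (transversal b l) := by
  have h3 := finrank_eq_three b
  refine ⟨finrank_transversal b l, ?_, ?_, ?_⟩
  · rintro x ⟨p, rfl⟩
    rfl
  · rw [eq_bot_iff]
    intro y hy
    simp only [rationalPart, Submodule.mem_comap, Submodule.restrictScalars_mem,
      mem_transversal_iff] at hy
    obtain ⟨h6, h⟩ := hy
    obtain ⟨α, β, hαβ⟩ := sigma_surjective b y
    -- One vanishing place other than l suffices: for a rational vector it holds conjugates of α and
    -- β, so both are zero.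
    have hl : l + 1 ≠ l := by fin_cases l <;> decide
    have h1 := h _ hl
    rw [← hαβ, coordX_embed_sigma, coordY_embed_sigma] at h1
    simp only [map_eq_zero] at h1
    have h7 : y 6 = 0 := by simpa using h6
    rw [Submodule.mem_bot, ← hαβ, h1.1, h1.2, h7]
    exact map_zero _
  · ext W
    rw [mem_spread_iff]
    simp only [Set.mem_ofPred_eq]
    constructor
    · rintro ⟨x, ⟨⟨α', β'⟩, rfl⟩, hx, rfl⟩
      obtain ⟨α, rfl⟩ := (frobPow_bijective h3 l).2 α'
      obtain ⟨β, rfl⟩ := (frobPow_bijective h3 l).2 β'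
      have h0 : (α, β) ≠ 0 := fun h => hx (by
        rw [Prod.mk_eq_zero] at h
        rw [h.1, h.2, map_zero]
        exact map_zero _)
      exact ⟨α, β, h0, mem_rationalPart_transversalVec b l α β⟩
    · rintro ⟨α, β, h0, hW⟩
      refine ⟨transversalVec b l (frobPow F K l α, frobPow F K l β), ⟨_, rfl⟩, fun h => h0 ?_, ?_⟩
      · have := transversalVec_injective b l (h.trans (map_zero _).symm)
        simpa using this
      · ext y
        rw [hW]
        exact (mem_rationalPart_transversalVec b l α β y).symm

/-- If the plane spanned by `x` and its conjugates meets `PG(6,q)` inside the spread element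
`[(α,β,0)]`, then `x` lies in the extension of that element. -/
theorem coord_mul_eq_of_rationalPart (b : Module.Basis (Fin 3) F K) {x : Fin 7 → K} {α β : K}
    (h : ∀ y ∈ rationalPart F (Submodule.span K {x, conj F x, conj F (conj F x)}),
      ∃ c, sigma b (c * α, c * β, 0) = y) (m : Fin 3) :
    coordX b m x * frobPow F K m β = coordY b m x * frobPow F K m α := by
  have h3 := finrank_eq_three b
  -- In place m this linear form cuts out the direction of the spread element; it vanishes on all
  -- its rational vectors.
  let Λ : (Fin 7 → K) →ₗ[K] K :=
    frobPow F K m β • coordX b m - frobPow F K m α • coordY b m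
  -- The sum of c x and its conjugates is fixed by conjugation, hence a rational vector of the
  -- plane, and Λ kills it. The values c = 1, θ, θ² then separate the three terms.
  have hΛ : ∀ c : K, c * Λ x + frob F K c * Λ (conj F x) +
      frob F K (frob F K c) * Λ (conj F (conj F x)) = 0 := by
    intro c
    obtain ⟨y, hy⟩ := exists_embed_eq_of_conj_eq (F := F) (x := c • x + frob F K c • conj F x +
      frob F K (frob F K c) • conj F (conj F x)) (by
        simp only [conj_add, conj_smul, frob_frob_frob h3, conj_conj_conj h3]
        abel)
    obtain ⟨d, hd⟩ := h y (by
      simp only [rationalPart, Submodule.mem_comap, Submodule.restrictScalars_mem,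
        Submodule.mem_span_triple]
      exact ⟨c, _, _, hy.symm⟩)
    have h1 := congrArg Λ hy
    simp only [map_add, map_smul, smul_eq_mul] at h1
    rw [← h1, ← hd]
    simp only [Λ, LinearMap.sub_apply, LinearMap.smul_apply, coordX_embed_sigma,
      coordY_embed_sigma, smul_eq_mul, map_mul]
    ring
  obtain ⟨θ, hθ⟩ := exists_notMem_range_algebraMap h3
  have e0 := hΛ 1
  have e1 := hΛ θ
  have e2 := hΛ (θ ^ 2)
  simp only [map_one, one_mul, map_pow] at e0 e1 e2
  have := (eq_zero_of_conjugates h3 hθ e0 (by linear_combination e1)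
    (by linear_combination e2)).1
  simp only [Λ, LinearMap.sub_apply, LinearMap.smul_apply, smul_eq_mul] at this
  linear_combination this

/-- The spread has no transversals other than the three lines `transversal b l`. -/
theorem IsTransversal.exists_eq {b : Module.Basis (Fin 3) F K} {g : Submodule K (Fin 7 → K)}
    (hg : IsTransversal b g) : ∃ l, g = transversal b l := by
  have h3 := finrank_eq_three b
  obtain ⟨hdim, hinf, -, hspread⟩ := hg
  have hpt : ∀ x ∈ g, x ≠ 0 → ∃ α β : K, (α, β) ≠ 0 ∧
      ∀ m, coordX b m x * frobPow F K m β = coordY b m x * frobPow F K m α := by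
    intro x hx h0
    have h1 : rationalPart F (Submodule.span K {x, conj F x, conj F (conj F x)}) ∈ spread b := by
      rw [← hspread]; exact ⟨x, hx, h0, rfl⟩
    obtain ⟨α, β, hαβ, hW⟩ := (mem_spread_iff b _).1 h1
    exact ⟨α, β, hαβ, coord_mul_eq_of_rationalPart b fun y hy => (hW y).1 hy⟩
  have hex : ∀ t : K, ∃ x ∈ g, x ≠ 0 ∧
      ∀ m, coordX b m x * frobPow F K m t = coordY b m x := by
    intro t
    have hv : ![(1 : K), t, 0] ≠ 0 := fun h => one_ne_zero (congrFun h 0)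
    have h1 : spreadElement b (Projectivization.mk K _ hv) ∈ spread b :=
      ⟨_, (mk_mem_lineAtInfinity hv).2 rfl, rfl⟩
    rw [← hspread] at h1
    obtain ⟨x, hx, h0, hW⟩ := h1
    refine ⟨x, hx, h0, fun m => ?_⟩
    have := coord_mul_eq_of_rationalPart b (x := x) (α := 1) (β := t) (fun y hy => by
      rw [← hW, mem_spreadElement_mk] at hy
      exact hy) m
    simpa using this
  choose x hxg hx0 hx using hex
  have hnz : ∀ t, ∃ m, coordX b m (x t) ≠ 0 := by
    intro t
    by_contra! h
    exact hx0 t (eq_zero_of_coord b (hinf (hxg t)) h (fun m => by rw [← hx t m, h, zero_mul]))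
  choose μ hμ using hnz
  have : Module.Finite F K := Module.Finite.of_basis b
  have : Finite K := Module.finite_of_finite F
  let _ := Fintype.ofFinite K
  -- Pigeonhole: more than three directions (1, t) occur on g, so two of them have a nonzero
  -- coordinate in a common place l.
  have hcard : Fintype.card (Fin 3) < Fintype.card K := by
    rw [← Nat.card_eq_fintype_card (α := K), Module.natCard_eq_pow_finrank (K := F) (V := K), h3,
      Fintype.card_fin]
    have : 1 < Nat.card F := Finite.one_lt_card
    calc 3 < 2 ^ 3 := by norm_num
      _ ≤ _ := Nat.pow_le_pow_left this 3
  obtain ⟨t, t', htt, hmm⟩ := Fintype.exists_ne_map_eq_of_card_lt μ hcard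
  set l := μ t with hl
  refine ⟨l, ?_⟩
  -- the projection to the coordinates in place `l` is bijective on `g`
  let p : g →ₗ[K] K × K := ((coordX b l).prod (coordY b l)).comp g.subtype
  have hp : ∀ y : g, p y = (coordX b l y, coordY b l y) := fun _ => rfl
  have hsurj : Function.Surjective p := by
    have hD : coordX b l (x t) * coordY b l (x t') - coordX b l (x t') * coordY b l (x t) ≠ 0 := by
      rw [← hx t, ← hx t']
      have h1 : frobPow F K l t' - frobPow F K l t ≠ 0 :=
        sub_ne_zero.mpr fun h => htt ((frobPow F K l).injective h).symm
      have h2 := hμ t'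
      rw [← hmm] at h2
      have h4 := mul_ne_zero (mul_ne_zero (hμ t) h2) h1
      intro h5
      apply h4
      rw [← h5]
      ring
    rintro ⟨u, w⟩
    refine ⟨((u * coordY b l (x t') - coordX b l (x t') * w) /
      (coordX b l (x t) * coordY b l (x t') - coordX b l (x t') * coordY b l (x t))) •
        (⟨x t, hxg t⟩ : g) +
      ((coordX b l (x t) * w - u * coordY b l (x t)) /
      (coordX b l (x t) * coordY b l (x t') - coordX b l (x t') * coordY b l (x t))) •
        (⟨x t', hxg t'⟩ : g), ?_⟩
    ext
    · simp only [hp, Submodule.coe_add, Submodule.coe_smul, map_add, map_smul, smul_eq_mul]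
      rw [div_mul_eq_mul_div, div_mul_eq_mul_div, ← add_div, div_eq_iff hD]
      ring
    · simp only [hp, Submodule.coe_add, Submodule.coe_smul, map_add, map_smul, smul_eq_mul]
      rw [div_mul_eq_mul_div, div_mul_eq_mul_div, ← add_div, div_eq_iff hD]
      ring
  have hinj : Function.Injective p :=
    (LinearMap.injective_iff_surjective_of_finrank_eq_finrank (by rw [hdim]; simp)).2 hsurj
  obtain ⟨⟨x1, hx1⟩, e1⟩ := hsurj (1, 0)
  obtain ⟨⟨x2, hx2⟩, e2⟩ := hsurj (0, 1)
  have e1X : coordX b l x1 = 1 := congrArg Prod.fst e1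
  have e1Y : coordY b l x1 = 0 := congrArg Prod.snd e1
  have e2X : coordX b l x2 = 0 := congrArg Prod.fst e2
  have e2Y : coordY b l x2 = 1 := congrArg Prod.snd e2
  have hx1ne : x1 ≠ 0 := fun h => by simp [h] at e1X
  have hx2ne : x2 ≠ 0 := fun h => by simp [h] at e2Y
  -- In place l the direction of x1 is (1, 0). As x1 lies in the extension of one spread element,
  -- that element has β = 0, which governs every other place.
  have f1 : ∀ m, coordY b m x1 = 0 := by
    intro m
    obtain ⟨α, β, hαβ, h⟩ := hpt x1 hx1 hx1ne
    have h1 := h l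
    rw [e1X, e1Y, one_mul, zero_mul, map_eq_zero] at h1
    have h2 := h m
    rw [h1, map_zero, mul_zero] at h2
    rcases mul_eq_zero.mp h2.symm with h4 | h4
    · exact h4
    · rw [map_eq_zero] at h4
      exact absurd (by rw [h1, h4]; rfl) hαβ
  have f2 : ∀ m, coordX b m x2 = 0 := by
    intro m
    obtain ⟨α, β, hαβ, h⟩ := hpt x2 hx2 hx2ne
    have h1 := h l
    rw [e2X, e2Y, one_mul, zero_mul, eq_comm, map_eq_zero] at h1
    have h2 := h m
    rw [h1, map_zero, mul_zero] at h2
    rcases mul_eq_zero.mp h2 with h4 | h4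
    · exact h4
    · rw [map_eq_zero] at h4
      exact absurd (by rw [h1, h4]; rfl) hαβ
  -- The same argument for x1 + φ^l(η) x2, whose spread element has direction (1, η), compares
  -- places l and m. Taking η = 1 and η = θ next shows that x1 and x2 vanish outside place l.
  have f3 : ∀ η m, coordX b m x1 * frobPow F K m η = frobPow F K l η * coordY b m x2 := by
    intro η m
    have hne : x1 + frobPow F K l η • x2 ≠ 0 := fun h => by
      have := congrArg (coordX b l) h
      simp [e1X, e2X] at this
    obtain ⟨α, β, hαβ, h⟩ := hpt _ (g.add_mem hx1 (g.smul_mem (frobPow F K l η) hx2)) hne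
    have h1 := h l
    simp only [map_add, map_smul, smul_eq_mul, e1X, e1Y, e2X, e2Y] at h1
    have hβ : β = η * α := (frobPow F K l).injective (by rw [map_mul]; linear_combination h1)
    have hα : frobPow F K m α ≠ 0 := by
      rw [Ne, map_eq_zero]
      rintro rfl
      exact hαβ (by rw [hβ, mul_zero]; rfl)
    have h2 := h m
    simp only [map_add, map_smul, smul_eq_mul, f1, f2, hβ, map_mul] at h2
    apply mul_right_cancel₀ hα
    linear_combination h2
  obtain ⟨θ, hθ⟩ := exists_notMem_range_algebraMap h3
  have f4 : ∀ m, m ≠ l → coordX b m x1 = 0 ∧ coordY b m x2 = 0 := by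
    intro m hm
    have h1 := f3 1 m
    rw [map_one, map_one, mul_one, one_mul] at h1
    have h2 := f3 θ m
    rw [h1] at h2
    have h4 : coordY b m x2 * (frobPow F K m θ - frobPow F K l θ) = 0 := by
      linear_combination h2
    have h5 := (mul_eq_zero.mp h4).resolve_right (sub_ne_zero.mpr (frobPow_ne_frobPow h3 hθ hm))
    exact ⟨h1.trans h5, h5⟩
  refine Submodule.eq_of_le_of_finrank_eq ?_ (by rw [hdim, finrank_transversal])
  intro y hy
  have hy2 : y = coordX b l y • x1 + coordY b l y • x2 := by
    have h1 : (⟨y, hy⟩ : g) =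
        coordX b l y • (⟨x1, hx1⟩ : g) + coordY b l y • (⟨x2, hx2⟩ : g) := by
      apply hinj
      rw [map_add, map_smul, map_smul, e1, e2]
      simp [p]
    exact congrArg Subtype.val h1
  rw [mem_transversal_iff]
  refine ⟨hinf hy, fun m hm => ?_⟩
  rw [hy2]
  simp [f1, f2, (f4 m hm).1, (f4 m hm).2]

end Transversals

/-! ### The `3`-space spanned by a spread element and an affine point -/

section SpreadCone

variable {F K : Type*} [Field F] [Field K] [Algebra F K]

/-- The map `(z,κ) ↦ σ(zP + κv, z)`, whose image is the `3`-space that joins the affine point `P`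
to the spread element `[v]`. -/
noncomputable def coneMap (b : Module.Basis (Fin 3) F K) (P v : K × K) :
    F × K →ₗ[F] (Fin 7 → F) where
  toFun p := sigma b (p.1 • P.1 + p.2 * v.1, p.1 • P.2 + p.2 * v.2, p.1)
  map_add' p r := by
    rw [← map_add]
    congr 1
    ext <;> simp only [Prod.fst_add, Prod.snd_add, add_smul, add_mul] <;> ring
  map_smul' c p := by
    rw [RingHom.id_apply, ← map_smul]
    congr 1
    ext <;> simp [smul_add, smul_smul]

theorem coneMap_apply (b : Module.Basis (Fin 3) F K) (P v : K × K) (p : F × K) :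
    coneMap b P v p = sigma b (p.1 • P.1 + p.2 * v.1, p.1 • P.2 + p.2 * v.2, p.1) := rfl

@[simp] theorem coneMap_six (b : Module.Basis (Fin 3) F K) (P v : K × K) (p : F × K) :
    coneMap b P v p 6 = p.1 := rfl

theorem coneMap_injective (b : Module.Basis (Fin 3) F K) (P : K × K) {v : K × K} (hv : v ≠ 0) :
    Function.Injective (coneMap b P v) := by
  rw [← LinearMap.ker_eq_bot, LinearMap.ker_eq_bot']
  rintro ⟨z, κ⟩ h
  have h1 := sigma_injective b (h.trans (map_zero (sigma b)).symm)
  simp only [Prod.mk_eq_zero] at h1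
  obtain ⟨h2, h3, rfl⟩ := h1
  simp only [zero_smul, zero_add, mul_eq_zero] at h2 h3
  by_cases hκ : κ = 0
  · rw [hκ]; rfl
  · exact absurd (Prod.ext (h2.resolve_left hκ) (h3.resolve_left hκ)) hv

theorem coneMap_ne_zero (b : Module.Basis (Fin 3) F K) (P : K × K) {v : K × K} (hv : v ≠ 0)
    {p : F × K} (hp : p ≠ 0) : coneMap b P v p ≠ 0 := fun h =>
  hp (coneMap_injective b P hv (h.trans (map_zero _).symm))

theorem vec_ne_zero {v : K × K} (hv : v ≠ 0) : ![v.1, v.2, 0] ≠ 0 := fun h =>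
  hv (Prod.ext (congrFun h 0) (congrFun h 1))

theorem mem_spreadElement_iff_coneMap (b : Module.Basis (Fin 3) F K) (P : K × K) {v : K × K}
    (hv : v ≠ 0) (x : Fin 7 → F) :
    x ∈ spreadElement b (Projectivization.mk K _ (vec_ne_zero hv)) ↔
      ∃ κ, coneMap b P v (0, κ) = x := by
  rw [mem_spreadElement_mk]
  simp [coneMap_apply]

theorem coordX_embed_coneMap [Finite F] (b : Module.Basis (Fin 3) F K) (P v : K × K) (l : Fin 3)
    (p : F × K) : coordX b l (embed F K (coneMap b P v p)) =
      algebraMap F K p.1 * frobPow F K l P.1 + frobPow F K l p.2 * frobPow F K l v.1 := by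
  rw [coneMap_apply, coordX_embed_sigma]
  simp [Algebra.smul_def]

theorem coordY_embed_coneMap [Finite F] (b : Module.Basis (Fin 3) F K) (P v : K × K) (l : Fin 3)
    (p : F × K) : coordY b l (embed F K (coneMap b P v p)) =
      algebraMap F K p.1 * frobPow F K l P.2 + frobPow F K l p.2 * frobPow F K l v.2 := by
  rw [coneMap_apply, coordY_embed_sigma]
  simp [Algebra.smul_def]

/-- The matrix of the map from `F⁴` whose composition with `coneMap` sends the `j`-th unit vector
to `(z j, k j)`. -/
noncomputable def coneMatrix (b : Module.Basis (Fin 3) F K) (P v : K × K) (z : Fin 4 → F)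
    (k : Fin 4 → K) : Matrix (Fin 7) (Fin 4) F :=
  Matrix.of fun i j => coneMap b P v (z j, k j) i

theorem coneMatrix_mulVec (b : Module.Basis (Fin 3) F K) (P v : K × K) (z : Fin 4 → F)
    (k : Fin 4 → K) (c : Fin 4 → F) :
    coneMatrix b P v z k *ᵥ c = coneMap b P v (c 0 * z 0 + c 1 * z 1 + c 2 * z 2 + c 3 * z 3,
      algebraMap F K (c 0) * k 0 + algebraMap F K (c 1) * k 1 + algebraMap F K (c 2) * k 2 +
        algebraMap F K (c 3) * k 3) := by
  have h : coneMap b P v (c 0 * z 0 + c 1 * z 1 + c 2 * z 2 + c 3 * z 3,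
      algebraMap F K (c 0) * k 0 + algebraMap F K (c 1) * k 1 + algebraMap F K (c 2) * k 2 +
        algebraMap F K (c 3) * k 3) = c 0 • coneMap b P v (z 0, k 0) +
        c 1 • coneMap b P v (z 1, k 1) + c 2 • coneMap b P v (z 2, k 2) +
        c 3 • coneMap b P v (z 3, k 3) := by
    rw [← map_smul, ← map_smul, ← map_smul, ← map_smul, ← map_add, ← map_add, ← map_add]
    congr 1
    ext <;> simp [Algebra.smul_def]
  rw [h]
  ext i
  simp [Matrix.mulVec, dotProduct, Fin.sum_univ_four, coneMatrix, mul_comm]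

theorem coneMatrix_map_mulVec (b : Module.Basis (Fin 3) F K) (P v : K × K) (z : Fin 4 → F)
    (k : Fin 4 → K) (c : Fin 4 → K) :
    (coneMatrix b P v z k).map (algebraMap F K) *ᵥ c =
      c 0 • embed F K (coneMap b P v (z 0, k 0)) + c 1 • embed F K (coneMap b P v (z 1, k 1)) +
      c 2 • embed F K (coneMap b P v (z 2, k 2)) + c 3 • embed F K (coneMap b P v (z 3, k 3)) := by
  ext i
  simp [Matrix.mulVec, dotProduct, Fin.sum_univ_four, coneMatrix, mul_comm]

theorem exists_eq_coneMatrix (b : Module.Basis (Fin 3) F K) (P v : K × K)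
    (M : Matrix (Fin 7) (Fin 4) F)
    (hM : LinearMap.range M.mulVecLin ≤ LinearMap.range (coneMap b P v)) :
    ∃ z k, M = coneMatrix b P v z k := by
  have h : ∀ j, ∃ p, coneMap b P v p = M *ᵥ Pi.single j 1 := fun j => hM ⟨_, rfl⟩
  choose p hp using h
  refine ⟨fun j => (p j).1, fun j => (p j).2, ?_⟩
  ext i j
  have := congrFun (hp j) i
  rw [Matrix.mulVec_single_one] at this
  exact this.symm

/-- Once the z-part vanishes, the contribution of P disappears, and place m holds a scalar times
φ^m(v). Since v is nonzero, that scalar, the m-th conjugate of the form k, must vanish for m ≠ l. -/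
theorem coneMatrix_map_mulVec_mem_transversal [Finite F] (b : Module.Basis (Fin 3) F K) (P : K × K)
    {v : K × K} (hv : v ≠ 0) (z : Fin 4 → F) (k : Fin 4 → K) (c : Fin 4 → K) (l : Fin 3) :
    (coneMatrix b P v z k).map (algebraMap F K) *ᵥ c ∈ transversal b l ↔
      c 0 * algebraMap F K (z 0) + c 1 * algebraMap F K (z 1) + c 2 * algebraMap F K (z 2) +
        c 3 * algebraMap F K (z 3) = 0 ∧
      ∀ m, m ≠ l → c 0 * frobPow F K m (k 0) + c 1 * frobPow F K m (k 1) +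
        c 2 * frobPow F K m (k 2) + c 3 * frobPow F K m (k 3) = 0 := by
  rw [mem_transversal_iff, coneMatrix_map_mulVec]
  simp only [map_add, map_smul, coordX_embed_coneMap, coordY_embed_coneMap, smul_eq_mul,
    Pi.add_apply, Pi.smul_apply, embed_apply, coneMap_six]
  refine and_congr_right fun h6 => forall_congr' fun m => imp_congr_right fun _ => ?_
  constructor
  · rintro ⟨hX, hY⟩
    by_contra hne
    have h1 : frobPow F K m v.1 = 0 := by
      refine (mul_eq_zero.mp ?_).resolve_left hne
      linear_combination hX - frobPow F K m P.1 * h6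
    have h2 : frobPow F K m v.2 = 0 := by
      refine (mul_eq_zero.mp ?_).resolve_left hne
      linear_combination hY - frobPow F K m P.2 * h6
    rw [map_eq_zero] at h1 h2
    exact hv (Prod.ext h1 h2)
  · intro h
    constructor
    · linear_combination frobPow F K m P.1 * h6 + frobPow F K m v.1 * h
    · linear_combination frobPow F K m P.2 * h6 + frobPow F K m v.2 * h

end SpreadCone

/-! ### Twisted cubics that meet the transversals -/

section NormalForm

variable {F K : Type*} [Field F] [Finite F] [Field K] [Algebra F K]

/-- The coefficients `z` and `k` are those of the binary cubic forms `c N(s - θt)` and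
`(m₁s + m₂t)(s - θ^q t)(s - θ^{q²} t)`. -/
structure IsNormalForm (θ : K) (c : F) (m₁ m₂ : K) (z : Fin 4 → F) (k : Fin 4 → K) : Prop where
  z_zero : z 0 = c
  z_one : algebraMap F K (z 1) =
    -algebraMap F K c * (θ + frob F K θ + frob F K (frob F K θ))
  z_two : algebraMap F K (z 2) = algebraMap F K c * (θ * frob F K θ +
    θ * frob F K (frob F K θ) + frob F K θ * frob F K (frob F K θ))
  z_three : algebraMap F K (z 3) =
    -algebraMap F K c * (θ * frob F K θ * frob F K (frob F K θ))
  k_zero : k 0 = m₁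
  k_one : k 1 = m₂ - m₁ * (frob F K θ + frob F K (frob F K θ))
  k_two : k 2 = m₁ * (frob F K θ * frob F K (frob F K θ)) -
    m₂ * (frob F K θ + frob F K (frob F K θ))
  k_three : k 3 = m₂ * (frob F K θ * frob F K (frob F K θ))

/-- A cubic with three given distinct roots. -/
theorem cubic_coeff_of_roots {x y w z₀ z₁ z₂ z₃ : K} (hxy : x - y ≠ 0) (hxw : x - w ≠ 0)
    (hyw : y - w ≠ 0) (hx : x ^ 3 * z₀ + x ^ 2 * z₁ + x * z₂ + z₃ = 0)
    (hy : y ^ 3 * z₀ + y ^ 2 * z₁ + y * z₂ + z₃ = 0)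
    (hw : w ^ 3 * z₀ + w ^ 2 * z₁ + w * z₂ + z₃ = 0) :
    z₁ = -z₀ * (x + y + w) ∧ z₂ = z₀ * (x * y + x * w + y * w) ∧ z₃ = -z₀ * (x * y * w) := by
  have h1 : (x ^ 2 + x * y + y ^ 2) * z₀ + (x + y) * z₁ + z₂ = 0 :=
    (mul_eq_zero.mp (by linear_combination hx - hy :
      (x - y) * ((x ^ 2 + x * y + y ^ 2) * z₀ + (x + y) * z₁ + z₂) = 0)).resolve_left hxy
  have h2 : (x ^ 2 + x * w + w ^ 2) * z₀ + (x + w) * z₁ + z₂ = 0 :=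
    (mul_eq_zero.mp (by linear_combination hx - hw :
      (x - w) * ((x ^ 2 + x * w + w ^ 2) * z₀ + (x + w) * z₁ + z₂) = 0)).resolve_left hxw
  have h4 : (x + y + w) * z₀ + z₁ = 0 :=
    (mul_eq_zero.mp (by linear_combination h1 - h2 :
      (y - w) * ((x + y + w) * z₀ + z₁) = 0)).resolve_left hyw
  have e1 : z₁ = -z₀ * (x + y + w) := by linear_combination h4
  have e2 : z₂ = z₀ * (x * y + x * w + y * w) := by
    linear_combination h1 - (x + y) * e1
  exact ⟨e1, e2, by linear_combination hx - x ^ 2 * e1 - x * e2⟩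

/-- A cubic with two given distinct roots. -/
theorem cubic_coeff_of_two_roots {y w k₀ k₁ k₂ k₃ : K} (hyw : y - w ≠ 0)
    (hy : y ^ 3 * k₀ + y ^ 2 * k₁ + y * k₂ + k₃ = 0)
    (hw : w ^ 3 * k₀ + w ^ 2 * k₁ + w * k₂ + k₃ = 0) :
    k₂ = k₀ * (y * w) - (k₁ + k₀ * (y + w)) * (y + w) ∧
      k₃ = (k₁ + k₀ * (y + w)) * (y * w) := by
  have h1 : (y ^ 2 + y * w + w ^ 2) * k₀ + (y + w) * k₁ + k₂ = 0 :=
    (mul_eq_zero.mp (by linear_combination hy - hw :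
      (y - w) * ((y ^ 2 + y * w + w ^ 2) * k₀ + (y + w) * k₁ + k₂) = 0)).resolve_left hyw
  have e1 : k₂ = k₀ * (y * w) - (k₁ + k₀ * (y + w)) * (y + w) := by linear_combination h1
  exact ⟨e1, by linear_combination hy - y * e1⟩

/-- The form z has coefficients in F, so all conjugates of θ are roots. For k, applying φ² to the
equation with m = 1 and φ to that with m = 2 gives the roots θ^{q²} and θ^q; the remaining linear
factor is free. -/
theorem exists_isNormalForm (h3 : Module.finrank F K = 3) {θ : K}
    (hθ : ∀ a : F, algebraMap F K a ≠ θ) {z : Fin 4 → F} {k : Fin 4 → K}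
    (hz : θ ^ 3 * algebraMap F K (z 0) + θ ^ 2 * algebraMap F K (z 1) +
      θ * algebraMap F K (z 2) + algebraMap F K (z 3) = 0)
    (hk : ∀ m : Fin 3, m ≠ 0 → θ ^ 3 * frobPow F K m (k 0) + θ ^ 2 * frobPow F K m (k 1) +
      θ * frobPow F K m (k 2) + frobPow F K m (k 3) = 0) :
    ∃ m₁ m₂, IsNormalForm θ (z 0) m₁ m₂ z k := by
  have e1 := sub_ne_zero.mpr (frob_ne hθ).symm
  have e2 := sub_ne_zero.mpr (frob_frob_ne h3 hθ).symm
  have e3 := sub_ne_zero.mpr (frob_frob_ne_frob hθ).symm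
  have hz1 := congrArg (frob F K) hz
  have hz2 := congrArg (frob F K) hz1
  simp only [map_add, map_mul, map_pow, map_zero, frob_algebraMap] at hz1 hz2
  have hk1 := congrArg (frob F K) (congrArg (frob F K) (hk 1 (by decide)))
  have hk2 := congrArg (frob F K) (hk 2 (by decide))
  simp only [frobPow_one, frobPow_two, map_add, map_mul, map_pow, map_zero,
    frob_frob_frob h3] at hk1 hk2
  obtain ⟨a1, a2, a3⟩ := cubic_coeff_of_roots e1 e2 e3 hz hz1 hz2
  obtain ⟨b1, b2⟩ := cubic_coeff_of_two_roots e3 hk2 hk1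
  exact ⟨k 0, k 1 + k 0 * (frob F K θ + frob F K (frob F K θ)), rfl, a1, a2, a3, rfl,
    by ring, b1, b2⟩

omit [Finite F] in
theorem sub_mul_ne_zero {θ : K} (hθ : ∀ a : F, algebraMap F K a ≠ θ) {s t : F}
    (hst : s ≠ 0 ∨ t ≠ 0) : algebraMap F K s - θ * algebraMap F K t ≠ 0 := by
  intro h
  by_cases ht : t = 0
  · rw [ht, map_zero, mul_zero, sub_zero, map_eq_zero] at h
    exact hst.elim (fun h' => h' h) (fun h' => h' ht)
  · have ht' : algebraMap F K t ≠ 0 := by rwa [Ne, map_eq_zero]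
    refine hθ (s / t) ?_
    rw [map_div₀, div_eq_iff ht']
    linear_combination h

theorem frob_sub_mul (θ : K) (s t : F) :
    frob F K (algebraMap F K s - θ * algebraMap F K t) =
      algebraMap F K s - frob F K θ * algebraMap F K t := by
  rw [map_sub, map_mul, frob_algebraMap, frob_algebraMap]

omit [Finite F] in
/-- A projective point whose vectors lie in the line spanned by `w`. -/
theorem submodule_le_span_singleton_iff {V : Type*} [AddCommGroup V] [Module F V] (D : ℙ F V)
    {w : V} (hw : w ≠ 0) :
    D.submodule ≤ Submodule.span F {w} ↔ D = Projectivization.mk F w hw := by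
  induction D using Projectivization.ind with
  | h u hu =>
    rw [Projectivization.submodule_mk, Submodule.span_singleton_le_iff_mem,
      Submodule.mem_span_singleton, Projectivization.mk_eq_mk_iff']

variable {θ : K} {c : F} {m₁ m₂ : K} {z : Fin 4 → F} {k : Fin 4 → K}

theorem IsNormalForm.eval_z (h : IsNormalForm θ c m₁ m₂ z k) (s t : F) :
    algebraMap F K (cubicPoint s t 0 * z 0 + cubicPoint s t 1 * z 1 + cubicPoint s t 2 * z 2 +
      cubicPoint s t 3 * z 3) =
    algebraMap F K c * ((algebraMap F K s - θ * algebraMap F K t) *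
      frob F K (algebraMap F K s - θ * algebraMap F K t) *
      frob F K (frob F K (algebraMap F K s - θ * algebraMap F K t))) := by
  simp only [cubicPoint, Matrix.cons_val, map_add, map_mul, map_pow, frob_sub_mul, h.z_zero,
    h.z_one, h.z_two, h.z_three]
  ring

theorem IsNormalForm.eval_k (h : IsNormalForm θ c m₁ m₂ z k) (s t : F) :
    algebraMap F K (cubicPoint s t 0) * k 0 + algebraMap F K (cubicPoint s t 1) * k 1 +
      algebraMap F K (cubicPoint s t 2) * k 2 + algebraMap F K (cubicPoint s t 3) * k 3 =
    (m₁ * algebraMap F K s + m₂ * algebraMap F K t) *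
      frob F K (algebraMap F K s - θ * algebraMap F K t) *
      frob F K (frob F K (algebraMap F K s - θ * algebraMap F K t)) := by
  simp only [cubicPoint, Matrix.cons_val, map_mul, map_pow, frob_sub_mul, h.k_zero,
    h.k_one, h.k_two, h.k_three]
  ring

/-- The z-coordinate is c times a norm, so the cubic has no rational point at infinity. -/
theorem IsNormalForm.eval_z_ne_zero (h : IsNormalForm θ c m₁ m₂ z k)
    (hθ : ∀ a : F, algebraMap F K a ≠ θ) (hc : c ≠ 0) {s t : F} (hst : s ≠ 0 ∨ t ≠ 0) :
    cubicPoint s t 0 * z 0 + cubicPoint s t 1 * z 1 + cubicPoint s t 2 * z 2 +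
      cubicPoint s t 3 * z 3 ≠ 0 := by
  intro h0
  have h1 := h.eval_z s t
  have hδ := sub_mul_ne_zero hθ hst
  rw [h0, map_zero] at h1
  refine mul_ne_zero ?_ (mul_ne_zero (mul_ne_zero hδ ?_) ?_) h1.symm <;>
    simpa only [Ne, map_eq_zero]

/-- The points at infinity of the tangent line at `(s,t)`. -/
theorem IsNormalForm.tangentLine_inf (h : IsNormalForm θ c m₁ m₂ z k)
    (hθ : ∀ a : F, algebraMap F K a ≠ θ) (hc : c ≠ 0)
    (b : Module.Basis (Fin 3) F K) (P v : K × K) {s t : F} (hst : s ≠ 0 ∨ t ≠ 0) :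
    tangentLine (coneMatrix b P v z k) s t ⊓ hyperplaneAtInfinity F = Submodule.span F
      {coneMap b P v (0, (m₁ * θ + m₂) / (algebraMap F K s - θ * algebraMap F K t) ^ 2)} := by
  have hz := h.eval_z_ne_zero hθ hc hst
  have hez := h.eval_z s t
  have hδ := sub_mul_ne_zero hθ hst
  set Z := cubicPoint s t 0 * z 0 + cubicPoint s t 1 * z 1 + cubicPoint s t 2 * z 2 +
      cubicPoint s t 3 * z 3 with hZ
  set Zs := cubicPointDs s t 0 * z 0 + cubicPointDs s t 1 * z 1 + cubicPointDs s t 2 * z 2 +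
      cubicPointDs s t 3 * z 3 with hZs
  set Zt := cubicPointDt s t 0 * z 0 + cubicPointDt s t 1 * z 1 + cubicPointDt s t 2 * z 2 +
      cubicPointDt s t 3 * z 3 with hZt
  have hc' : algebraMap F K c ≠ 0 := by rwa [Ne, map_eq_zero]
  -- With κ/z = (m₁s + m₂t)/(cδ), the partial derivatives in s and t are -t and s times (m₁θ +
  -- m₂)/(cδ²). A tangent vector with z = 0 has κ equal to Z times the corresponding derivative of
  -- this quotient.
  have key : ∀ x y w : F, x * Z + y * Zs + w * Zt = 0 →
      x • (coneMatrix b P v z k *ᵥ cubicPoint s t) +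
        y • (coneMatrix b P v z k *ᵥ cubicPointDs s t) +
        w • (coneMatrix b P v z k *ᵥ cubicPointDt s t) = ((w * s - y * t) * Z / c) •
        coneMap b P v (0, (m₁ * θ + m₂) / (algebraMap F K s - θ * algebraMap F K t) ^ 2) := by
    intro x y w hxyw
    rw [coneMatrix_mulVec, coneMatrix_mulVec, coneMatrix_mulVec, ← map_smul, ← map_smul,
      ← map_smul, ← map_smul, ← map_add, ← map_add]
    congr 1
    ext
    · simpa using hxyw
    · simp only [Prod.snd_add, Prod.smul_snd]
      simp only [Algebra.smul_def]
      have h1 := congrArg (algebraMap F K) hxyw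
      rw [map_div₀, map_mul, hez, mul_div_assoc', div_mul_eq_mul_div, div_div,
        eq_div_iff (mul_ne_zero hc' (pow_ne_zero 2 hδ))]
      -- This is the condition z = 0 divided by c, with the partial derivatives expanded by the
      -- product rule over the three conjugate factors.
      have h2 : algebraMap F K x * ((algebraMap F K s - θ * algebraMap F K t) *
          (algebraMap F K s - frob F K θ * algebraMap F K t) *
          (algebraMap F K s - frob F K (frob F K θ) * algebraMap F K t)) + algebraMap F K y *
          ((algebraMap F K s - frob F K θ * algebraMap F K t) *
          (algebraMap F K s - frob F K (frob F K θ) * algebraMap F K t) +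
          (algebraMap F K s - θ * algebraMap F K t) *
          (algebraMap F K s - frob F K (frob F K θ) * algebraMap F K t) +
          (algebraMap F K s - θ * algebraMap F K t) *
          (algebraMap F K s - frob F K θ * algebraMap F K t)) - algebraMap F K w *
          (θ * ((algebraMap F K s - frob F K θ * algebraMap F K t) *
          (algebraMap F K s - frob F K (frob F K θ) * algebraMap F K t)) +
          frob F K θ * ((algebraMap F K s - θ * algebraMap F K t) *
          (algebraMap F K s - frob F K (frob F K θ) * algebraMap F K t)) +
          frob F K (frob F K θ) * ((algebraMap F K s - θ * algebraMap F K t) *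
          (algebraMap F K s - frob F K θ * algebraMap F K t))) = 0 := by
        refine (mul_eq_zero.mp (?_ : algebraMap F K c * _ = 0)).resolve_left hc'
        rw [map_add, map_add, map_mul, map_mul, map_mul, hez, hZs, hZt, map_zero] at h1
        simp only [cubicPointDs, cubicPointDt, Matrix.cons_val, map_add, map_mul, map_pow,
          frob_sub_mul, h.z_zero, h.z_one, h.z_two, h.z_three, map_ofNat, map_zero] at h1
        linear_combination h1
      simp only [cubicPoint, cubicPointDs, cubicPointDt, Matrix.cons_val, map_mul,
        map_pow, map_sub, frob_algebraMap, h.k_zero, h.k_one, h.k_two, h.k_three, map_ofNat,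
        map_zero]
      linear_combination algebraMap F K c * (algebraMap F K s - θ * algebraMap F K t) *
        (m₁ * algebraMap F K s + m₂ * algebraMap F K t) * h2
  have hsix : ∀ x y w : F, (x • (coneMatrix b P v z k *ᵥ cubicPoint s t) +
        y • (coneMatrix b P v z k *ᵥ cubicPointDs s t) +
        w • (coneMatrix b P v z k *ᵥ cubicPointDt s t)) 6 = x * Z + y * Zs + w * Zt := by
    intro x y w
    simp only [coneMatrix_mulVec, Pi.add_apply, Pi.smul_apply, coneMap_six, smul_eq_mul]
    rfl
  apply le_antisymm
  · rintro u ⟨hu, hu6⟩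
    obtain ⟨x, y, w, rfl⟩ := Submodule.mem_span_triple.1 hu
    rw [key x y w ((hsix x y w).symm.trans hu6)]
    exact Submodule.smul_mem _ _ (Submodule.mem_span_singleton_self _)
  · rw [Submodule.span_singleton_le_iff_mem]
    refine ⟨?_, rfl⟩
    -- A direction transverse to (s, t) makes the factor in `key` nonzero; the coefficient of the
    -- point itself is then chosen to cancel z.
    obtain ⟨y, w, hyw⟩ : ∃ y w : F, w * s - y * t = 1 := by
      rcases hst with hs | ht
      · exact ⟨0, s⁻¹, by rw [inv_mul_cancel₀ hs]; ring⟩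
      · exact ⟨-t⁻¹, 0, by rw [neg_mul, inv_mul_cancel₀ ht]; ring⟩
    have h1 := key (-(y * Zs + w * Zt) / Z) y w (by rw [div_mul_cancel₀ _ hz]; ring)
    rw [hyw, one_mul] at h1
    have h2 : coneMap b P v (0, (m₁ * θ + m₂) / (algebraMap F K s - θ * algebraMap F K t) ^ 2) =
        (c / Z) • (Z / c) • coneMap b P v
          (0, (m₁ * θ + m₂) / (algebraMap F K s - θ * algebraMap F K t) ^ 2) := by
      rw [smul_smul, div_mul_div_cancel₀ hz, div_self hc, one_smul]
    rw [h2, ← h1]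
    exact Submodule.smul_mem _ _ (Submodule.mem_span_triple.2 ⟨_, _, _, rfl⟩)

end NormalForm

/-! ### Sublines disjoint from the line at infinity -/

section Subline

variable {F K : Type*} [Field F] [Field K] [Algebra F K]

/-- The affine points of `l` are the points `P + (t / (s - θt)) v` with `(s,t) ∈ PG(1,q)`. -/
def HasAffineParam (F : Type*) {K : Type*} [Field F] [Field K] [Algebra F K]
    (l : Set (ℙ K (Fin 3 → K))) (θ : K) (P v : K × K) : Prop :=
  ∀ α β, (∃ h : ![α, β, 1] ≠ 0, Projectivization.mk K ![α, β, 1] h ∈ l) ↔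
    ∃ s t : F, (s ≠ 0 ∨ t ≠ 0) ∧
      α = P.1 + algebraMap F K t / (algebraMap F K s - θ * algebraMap F K t) * v.1 ∧
      β = P.2 + algebraMap F K t / (algebraMap F K s - θ * algebraMap F K t) * v.2

theorem mem_affineImage_iff (b : Module.Basis (Fin 3) F K) {l : Set (ℙ K (Fin 3 → K))} {θ : K}
    {P v : K × K} (hv : v ≠ 0) (hl : HasAffineParam F l θ P v) (Q : ℙ F (Fin 7 → F)) :
    Q ∈ affineImage b l ↔ ∃ s t : F, (s ≠ 0 ∨ t ≠ 0) ∧ Q = Projectivization.mk F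
      (coneMap b P v (1, algebraMap F K t / (algebraMap F K s - θ * algebraMap F K t)))
      (coneMap_ne_zero b P hv (by simp)) := by
  constructor
  · rintro ⟨α, β, h, h', hmem, rfl⟩
    obtain ⟨s, t, hst, rfl, rfl⟩ := (hl α β).1 ⟨h, hmem⟩
    refine ⟨s, t, hst, ?_⟩
    simp only [coneMap_apply, one_smul]
  · rintro ⟨s, t, hst, rfl⟩
    obtain ⟨h, hmem⟩ := (hl _ _).2 ⟨s, t, hst, rfl, rfl⟩
    refine ⟨_, _, h, fun h0 => ?_, hmem, ?_⟩
    · exact one_ne_zero (congrFun h0 6)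
    · simp only [coneMap_apply, one_smul]

/-- The points are sA + tB with third coordinate A₂(s - θt) for θ = -B₂/A₂. Disjointness makes A₂
nonzero and keeps θ out of F. Dividing by it gives P = A/A₂ and v = (B + θA)/A₂, and v is the
direction of the line at infinity. -/
theorem IsSubline.exists_hasAffineParam {l : Set (ℙ K (Fin 3 → K))} (hl : IsSubline F l)
    (hdisj : Disjoint l (lineAtInfinity K)) {L : ℙ K (Fin 3 → K)} (hL : L ∈ lineAtInfinity K)
    (hLl : L ∈ Projectivization.Subspace.span l) :
    ∃ (θ : K) (P v : K × K) (hv : v ≠ 0), (∀ a : F, algebraMap F K a ≠ θ) ∧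
      HasAffineParam F l θ P v ∧ L = Projectivization.mk K _ (vec_ne_zero hv) := by
  obtain ⟨g, rfl⟩ := hl
  set A := g ![1, 0, 0] with hA
  set B := g ![0, 1, 0] with hB
  have hg : ∀ s t : K, g ![s, t, 0] = s • A + t • B := by
    intro s t
    rw [hA, hB, ← map_smul, ← map_smul, ← map_add]
    congr 1
    ext i; fin_cases i <;> simp
  have hst0 : ∀ {s t : F}, (s ≠ 0 ∨ t ≠ 0) → ![algebraMap F K s, algebraMap F K t, 0] ≠ 0 := by
    intro s t hst h0
    have h1 := congrFun h0 0
    have h2 := congrFun h0 1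
    simp at h1 h2
    simp [h1, h2] at hst
  have hgne : ∀ {s t : F}, (s ≠ 0 ∨ t ≠ 0) → algebraMap F K s • A + algebraMap F K t • B ≠ 0 := by
    intro s t hst h0
    rw [← hg, map_eq_zero_iff _ g.injective] at h0
    exact hst0 hst h0
  have hmem : ∀ X, X ∈ Projectivization.map (g : (Fin 3 → K) →ₗ[K] (Fin 3 → K)) g.injective ''
      standardSubline F K ↔ ∃ (s t : F) (hst : s ≠ 0 ∨ t ≠ 0),
        X = Projectivization.mk K (algebraMap F K s • A + algebraMap F K t • B) (hgne hst) := by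
    intro X
    constructor
    · rintro ⟨_, ⟨s, t, h, rfl⟩, rfl⟩
      have hst : s ≠ 0 ∨ t ≠ 0 := by
        by_contra! h0
        apply h
        rw [h0.1, h0.2]
        ext i; fin_cases i <;> simp
      refine ⟨s, t, hst, ?_⟩
      rw [Projectivization.map_mk]
      simp only [LinearEquiv.coe_coe, hg]
    · rintro ⟨s, t, hst, rfl⟩
      refine ⟨_, ⟨s, t, hst0 hst, rfl⟩, ?_⟩
      rw [Projectivization.map_mk]
      simp only [LinearEquiv.coe_coe, hg]
  have hδ : ∀ {s t : F}, (s ≠ 0 ∨ t ≠ 0) →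
      algebraMap F K s * A 2 + algebraMap F K t * B 2 ≠ 0 := by
    intro s t hst h0
    exact Set.disjoint_left.1 hdisj ((hmem _).2 ⟨s, t, hst, rfl⟩)
      ((mk_mem_lineAtInfinity (hgne hst)).2 h0)
  have hA2 : A 2 ≠ 0 := by simpa using hδ (s := 1) (t := 0) (by simp)
  have hBA : B + (-B 2 / A 2) • A ≠ 0 := by
    intro h0
    have h1 := hg (-B 2 / A 2) 1
    rw [one_smul, add_comm, h0, map_eq_zero_iff _ g.injective] at h1
    exact one_ne_zero (congrFun h1 1)
  have hBA2 : (B + (-B 2 / A 2) • A) 2 = 0 := by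
    simp only [Pi.add_apply, Pi.smul_apply, smul_eq_mul]
    rw [div_mul_cancel₀ _ hA2, add_neg_cancel]
  have hv : ((B 0 + -B 2 / A 2 * A 0) / A 2, (B 1 + -B 2 / A 2 * A 1) / A 2) ≠ 0 := by
    intro h0
    simp only [Prod.mk_eq_zero, div_eq_zero_iff, hA2, or_false] at h0
    apply hBA
    ext i
    fin_cases i
    · exact h0.1
    · exact h0.2
    · exact hBA2
  refine ⟨-B 2 / A 2, (A 0 / A 2, A 1 / A 2), _, hv, ?_, ?_, ?_⟩
  · intro a ha
    apply hδ (s := a) (t := 1) (by simp)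
    rw [ha, div_mul_cancel₀ _ hA2]
    simp
  · have hform : ∀ {s t : F} (hst : s ≠ 0 ∨ t ≠ 0) (x y : K),
        x / A 2 + algebraMap F K t / (algebraMap F K s - -B 2 / A 2 * algebraMap F K t) *
          ((y + -B 2 / A 2 * x) / A 2) =
        (algebraMap F K s * x + algebraMap F K t * y) /
          (algebraMap F K s * A 2 + algebraMap F K t * B 2) := by
      intro s t hst x y
      have h1 := hδ hst
      have h2 : algebraMap F K s - -B 2 / A 2 * algebraMap F K t =
          (algebraMap F K s * A 2 + algebraMap F K t * B 2) / A 2 := by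
        field_simp
        ring
      rw [h2, eq_div_iff h1]
      generalize hD : algebraMap F K s * A 2 + algebraMap F K t * B 2 = D at h1 ⊢
      field_simp
      rw [← hD]
      ring
    intro α β
    constructor
    · rintro ⟨h, hm⟩
      obtain ⟨s, t, hst, hX⟩ := (hmem _).1 hm
      refine ⟨s, t, hst, ?_⟩
      rw [hform hst, hform hst]
      rw [Projectivization.mk_eq_mk_iff'] at hX
      obtain ⟨a, ha⟩ := hX
      have h0 := congrFun ha 0
      have h1 := congrFun ha 1
      have h2 := congrFun ha 2
      simp [Algebra.smul_def] at h0 h1 h2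
      rw [eq_div_iff (hδ hst), eq_div_iff (hδ hst), ← h0, ← h1]
      constructor
      · linear_combination (algebraMap F K s * A 0 + algebraMap F K t * B 0) * h2
      · linear_combination (algebraMap F K s * A 1 + algebraMap F K t * B 1) * h2
    · rintro ⟨s, t, hst, hα, hβ⟩
      rw [hform hst] at hα hβ
      refine ⟨fun h0 => one_ne_zero (congrFun h0 2), (hmem _).2 ⟨s, t, hst, ?_⟩⟩
      rw [Projectivization.mk_eq_mk_iff']
      refine ⟨(algebraMap F K s * A 2 + algebraMap F K t * B 2)⁻¹, ?_⟩
      ext i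
      fin_cases i
      · simp [hα, div_eq_inv_mul, Algebra.smul_def]
      · simp [hβ, div_eq_inv_mul, Algebra.smul_def]
      · simpa [Algebra.smul_def] using inv_mul_cancel₀ (hδ hst)
  · have hspan : Projectivization.Subspace.span
        (Projectivization.map (g : (Fin 3 → K) →ₗ[K] (Fin 3 → K)) g.injective ''
          standardSubline F K) ≤ (Submodule.span K {A, B}).projectivization := by
      rw [Projectivization.Subspace.span_le_subspace_iff]
      intro X hX
      obtain ⟨s, t, hst, rfl⟩ := (hmem X).1 hX
      exact (Submodule.mk_mem_projectivization_iff _ _).2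
        (Submodule.mem_span_pair.2 ⟨_, _, rfl⟩)
    have hL1 := hspan hLl
    induction L using Projectivization.ind with
    | h w hw =>
      rw [Submodule.mk_mem_projectivization_iff, Submodule.mem_span_pair] at hL1
      obtain ⟨x, y, rfl⟩ := hL1
      rw [mk_mem_lineAtInfinity] at hL
      rw [Projectivization.mk_eq_mk_iff']
      simp only [Pi.add_apply, Pi.smul_apply, smul_eq_mul] at hL
      have hx : x = y * (-B 2 / A 2) := by
        rw [mul_div_assoc', eq_div_iff hA2]
        linear_combination hL
      refine ⟨y * A 2, ?_⟩
      ext i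
      fin_cases i
      · simp [hx]
        field_simp
        ring
      · simp [hx]
        field_simp
        ring
      · simpa using hL.symm

/-- Two parametrisations of the same subline differ by an element of `GL(2,q)` and a scalar. -/
theorem exists_reparam {θ θ₀ m₁ m₂ : K} (hθ : ∀ a : F, algebraMap F K a ≠ θ)
    (hθ₀ : ∀ a : F, algebraMap F K a ≠ θ₀) (hΔ : m₁ * θ + m₂ ≠ 0)
    (h : ∀ s t : F, (s ≠ 0 ∨ t ≠ 0) → ∃ s' t' : F, (s' ≠ 0 ∨ t' ≠ 0) ∧
      (m₁ * algebraMap F K s + m₂ * algebraMap F K t) *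
        (algebraMap F K s' - θ₀ * algebraMap F K t') =
      algebraMap F K t' * (algebraMap F K s - θ * algebraMap F K t)) :
    ∃ (μ : K) (a₁ a₂ c₁ c₂ : F), μ ≠ 0 ∧ a₁ * c₂ - a₂ * c₁ ≠ 0 ∧
      m₁ * θ + m₂ = μ ^ 2 * algebraMap F K (a₁ * c₂ - a₂ * c₁) ∧
      ∀ s t : F, algebraMap F K s - θ * algebraMap F K t =
        μ * (algebraMap F K (a₁ * s + a₂ * t) - θ₀ * algebraMap F K (c₁ * s + c₂ * t)) := by
  have aux : ∀ s t : F, (s ≠ 0 ∨ t ≠ 0) → ∃ (μ : K) (s' t' : F), μ ≠ 0 ∧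
      m₁ * algebraMap F K s + m₂ * algebraMap F K t = μ * algebraMap F K t' ∧
      algebraMap F K s - θ * algebraMap F K t =
        μ * (algebraMap F K s' - θ₀ * algebraMap F K t') := by
    intro s t hst
    obtain ⟨s', t', hst', h1⟩ := h s t hst
    have h2 := sub_mul_ne_zero hθ₀ hst'
    have h4 := sub_mul_ne_zero hθ hst
    refine ⟨(algebraMap F K s - θ * algebraMap F K t) /
      (algebraMap F K s' - θ₀ * algebraMap F K t'), s', t', div_ne_zero h4 h2, ?_, ?_⟩
    · rw [div_mul_eq_mul_div, eq_div_iff h2, h1, mul_comm]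
    · rw [div_mul_cancel₀ _ h2]
  -- As for any projectivity of a line, the images of (1,0), (0,1) and (1,1) suffice.
  obtain ⟨μ₁, s₁, t₁, hμ₁, e1, f1⟩ := aux 1 0 (by simp)
  obtain ⟨μ₂, s₂, t₂, hμ₂, e2, f2⟩ := aux 0 1 (by simp)
  obtain ⟨μ₃, s₃, t₃, hμ₃, e3, f3⟩ := aux 1 1 (by simp)
  simp only [map_one, map_zero, mul_one, mul_zero, add_zero, zero_add, sub_zero, zero_sub]
    at e1 f1 e2 f2 e3 f3
  have hs : μ₁ * algebraMap F K s₁ + μ₂ * algebraMap F K s₂ = μ₃ * algebraMap F K s₃ := by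
    linear_combination f3 - f1 - f2 + θ₀ * (e3 - e1 - e2)
  have ht : μ₁ * algebraMap F K t₁ + μ₂ * algebraMap F K t₂ = μ₃ * algebraMap F K t₃ := by
    linear_combination e3 - e1 - e2
  have hdet : m₁ * θ + m₂ = μ₁ * μ₂ * algebraMap F K (s₁ * t₂ - s₂ * t₁) := by
    rw [map_sub, map_mul, map_mul]
    linear_combination θ * e1 + e2 - μ₁ * algebraMap F K t₁ * f2 + μ₂ * algebraMap F K t₂ * f1
  have hD' : algebraMap F K (s₁ * t₂ - s₂ * t₁) ≠ 0 := fun h0 => hΔ (by rw [hdet, h0, mul_zero])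
  have hD : s₁ * t₂ - s₂ * t₁ ≠ 0 := fun h0 => hD' (by rw [h0, map_zero])
  -- Cramer's rule on `hs` and `ht`: both scalars are F-multiples of one μ, and these multiples are
  -- absorbed into the matrix.
  have g1 : μ₁ = μ₃ / algebraMap F K (s₁ * t₂ - s₂ * t₁) * algebraMap F K (s₃ * t₂ - s₂ * t₃) := by
    rw [div_mul_eq_mul_div, eq_div_iff hD']
    simp only [map_sub, map_mul]
    linear_combination algebraMap F K t₂ * hs - algebraMap F K s₂ * ht
  have g2 : μ₂ = μ₃ / algebraMap F K (s₁ * t₂ - s₂ * t₁) * algebraMap F K (s₁ * t₃ - s₃ * t₁) := by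
    rw [div_mul_eq_mul_div, eq_div_iff hD']
    simp only [map_sub, map_mul]
    linear_combination algebraMap F K s₁ * ht - algebraMap F K t₁ * hs
  set μ := μ₃ / algebraMap F K (s₁ * t₂ - s₂ * t₁)
  set d₁ := s₃ * t₂ - s₂ * t₃
  set d₂ := s₁ * t₃ - s₃ * t₁
  have hd₁ : d₁ ≠ 0 := fun h0 => hμ₁ (by rw [g1, h0, map_zero, mul_zero])
  have hd₂ : d₂ ≠ 0 := fun h0 => hμ₂ (by rw [g2, h0, map_zero, mul_zero])
  refine ⟨μ, d₁ * s₁, d₂ * s₂, d₁ * t₁, d₂ * t₂, div_ne_zero hμ₃ hD', ?_, ?_, ?_⟩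
  · have : d₁ * s₁ * (d₂ * t₂) - d₂ * s₂ * (d₁ * t₁) = d₁ * d₂ * (s₁ * t₂ - s₂ * t₁) := by ring
    rw [this]
    exact mul_ne_zero (mul_ne_zero hd₁ hd₂) hD
  · rw [hdet, g1, g2]
    simp only [map_sub, map_mul]
    ring
  · intro s t
    rw [g1] at f1
    rw [g2] at f2
    simp only [map_add, map_mul]
    linear_combination algebraMap F K s * f1 + algebraMap F K t * f2

end Subline

/-! ### The shadow of a subline -/

section Shadow

variable {F K : Type*} [Field F] [Finite F] [Field K] [Algebra F K]

omit [Finite F] in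
theorem cubicPoint_ne_zero {s t : F} (hst : s ≠ 0 ∨ t ≠ 0) : cubicPoint s t ≠ 0 := by
  intro h
  have h0 : s ^ 3 = 0 := congrFun h 0
  have h3 : t ^ 3 = 0 := congrFun h 3
  exact hst.elim (fun hs => hs (pow_eq_zero_iff (by norm_num) |>.1 h0))
    (fun ht => ht (pow_eq_zero_iff (by norm_num) |>.1 h3))

omit [Finite F] in
/-- The spread elements are planes. -/
theorem finrank_of_mem_spread {b : Module.Basis (Fin 3) F K} {W : Submodule F (Fin 7 → F)}
    (hW : W ∈ spread b) : Module.finrank F W = 3 := by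
  obtain ⟨α, β, h0, hW⟩ := (mem_spread_iff b W).1 hW
  have hne : (α, β) ≠ (0 : K × K) := h0
  have hrange : W = LinearMap.range ((coneMap b 0 (α, β)).comp (LinearMap.inr F F K)) := by
    ext x
    rw [hW]
    simp [coneMap_apply]
  have hi : Function.Injective ((coneMap b 0 (α, β)).comp (LinearMap.inr F F K)) :=
    (coneMap_injective b 0 hne).comp LinearMap.inr_injective
  rw [hrange, LinearMap.finrank_range_of_inj hi, finrank_eq_three b]

variable {b : Module.Basis (Fin 3) F K} {l : Set (ℙ K (Fin 3 → K))} {θ : K} {P v : K × K}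

omit [Finite F] in
theorem exists_mulVec_eq_of_cubicPoints (hv : v ≠ 0) (hl : HasAffineParam F l θ P v)
    {M : Matrix (Fin 7) (Fin 4) F} (hinj : Function.Injective M.mulVec)
    (hM : cubicPoints M = affineImage b l) {s t : F} (hst : s ≠ 0 ∨ t ≠ 0) :
    ∃ (a s' t' : F), a ≠ 0 ∧ (s' ≠ 0 ∨ t' ≠ 0) ∧ M *ᵥ cubicPoint s t = coneMap b P v
      (a, algebraMap F K a * (algebraMap F K t' / (algebraMap F K s' - θ * algebraMap F K t'))) := by
  have h0 : M *ᵥ cubicPoint s t ≠ 0 := fun h =>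
    cubicPoint_ne_zero hst (hinj (h.trans (Matrix.mulVec_zero M).symm))
  have h1 : Projectivization.mk F (M *ᵥ cubicPoint s t) h0 ∈ affineImage b l := by
    rw [← hM]; exact ⟨s, t, h0, rfl⟩
  obtain ⟨s', t', hst', h2⟩ := (mem_affineImage_iff b hv hl _).1 h1
  rw [Projectivization.mk_eq_mk_iff'] at h2
  obtain ⟨a, ha⟩ := h2
  refine ⟨a, s', t', ?_, hst', ?_⟩
  · rintro rfl
    rw [zero_smul] at ha
    exact h0 ha.symm
  · rw [← ha, ← map_smul]
    congr 1
    ext <;> simp [Algebra.smul_def]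

omit [Finite F] in
theorem exists_coneMap_mem_range (hv : v ≠ 0) (hl : HasAffineParam F l θ P v)
    {M : Matrix (Fin 7) (Fin 4) F} (hM : cubicPoints M = affineImage b l) {s t : F}
    (hst : s ≠ 0 ∨ t ≠ 0) : coneMap b P v
      (1, algebraMap F K t / (algebraMap F K s - θ * algebraMap F K t)) ∈
        LinearMap.range M.mulVecLin := by
  have h1 := (mem_affineImage_iff b hv hl _).2 ⟨s, t, hst, rfl⟩
  rw [← hM] at h1
  obtain ⟨x, y, h0, h2⟩ := h1
  rw [Projectivization.mk_eq_mk_iff'] at h2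
  obtain ⟨a, ha⟩ := h2
  rw [← ha]
  exact Submodule.smul_mem _ _ ⟨_, rfl⟩

omit [Finite F] in
-- By dimension the 3-space meets Σ∞ exactly in its spread element. The difference of two affine
-- points of the subline is a K-multiple of v, so that element is [v], and P completes the span.
theorem IsSpecialTwistedCubic.range_le (hv : v ≠ 0) (hθ : ∀ a : F, algebraMap F K a ≠ θ)
    (hl : HasAffineParam F l θ P v) {M : Matrix (Fin 7) (Fin 4) F}
    (hsp : IsSpecialTwistedCubic b M) (hM : cubicPoints M = affineImage b l) :
    LinearMap.range M.mulVecLin ≤ LinearMap.range (coneMap b P v) := by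
  obtain ⟨hinj, ⟨W, hWs, hWM⟩, hnot, -⟩ := hsp
  have hrank : Module.finrank F (LinearMap.range M.mulVecLin) = 4 := by
    rw [LinearMap.finrank_range_of_inj hinj]; simp
  have hW3 := finrank_of_mem_spread hWs
  obtain ⟨α, β, hαβ, hW⟩ := (mem_spread_iff b W).1 hWs
  have hWinf : W ≤ hyperplaneAtInfinity F := by
    intro x hx
    obtain ⟨c, rfl⟩ := (hW x).1 hx
    rfl
  have hWeq : W = LinearMap.range M.mulVecLin ⊓ hyperplaneAtInfinity F := by
    apply Submodule.eq_of_le_of_finrank_le (le_inf hWM hWinf)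
    have hlt : LinearMap.range M.mulVecLin ⊓ hyperplaneAtInfinity F <
        LinearMap.range M.mulVecLin :=
      lt_of_le_of_ne inf_le_left fun h => hnot (inf_eq_left.1 h)
    have := Submodule.finrank_lt_finrank_of_lt hlt
    omega
  have h1 := exists_coneMap_mem_range hv hl hM (s := 1) (t := 0) (by simp)
  have h2 := exists_coneMap_mem_range hv hl hM (s := 0) (t := 1) (by simp)
  simp only [map_one, map_zero, mul_one, mul_zero, zero_sub, sub_zero, div_one] at h1 h2
  have hθ0 : θ ≠ 0 := fun h => hθ 0 (by rw [h, map_zero])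
  have hdiff : coneMap b P v (0, 1 / -θ) ∈ W := by
    rw [hWeq]
    refine ⟨?_, rfl⟩
    have := Submodule.sub_mem _ h2 h1
    rw [← map_sub] at this
    simpa using this
  obtain ⟨c, hc⟩ := (hW _).1 hdiff
  rw [coneMap_apply] at hc
  have hc2 := sigma_injective b hc
  simp only [Prod.mk.injEq, zero_smul, zero_add, and_true] at hc2
  have hc0 : c ≠ 0 := by
    rintro rfl
    simp only [zero_mul] at hc2
    have hu : 1 / -θ ≠ 0 := by simp [hθ0]
    exact hv (Prod.ext ((mul_eq_zero.mp hc2.1.symm).resolve_left hu)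
      ((mul_eq_zero.mp hc2.2.symm).resolve_left hu))
  have hWle : W ≤ LinearMap.range (coneMap b P v) := by
    intro x hx
    obtain ⟨d, rfl⟩ := (hW x).1 hx
    refine ⟨(0, d * (1 / -θ) / c), ?_⟩
    rw [coneMap_apply]
    congr 1
    simp only [Prod.mk.injEq, zero_smul, zero_add, and_true]
    constructor
    · rw [div_mul_eq_mul_div, div_eq_iff hc0]; linear_combination -d * hc2.1
    · rw [div_mul_eq_mul_div, div_eq_iff hc0]; linear_combination -d * hc2.2
  intro y hy
  have h4 : y - y 6 • coneMap b P v (1, 0) ∈ W := by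
    rw [hWeq]
    refine ⟨Submodule.sub_mem _ hy (Submodule.smul_mem _ _ h1), ?_⟩
    change y 6 - y 6 * 1 = 0
    ring
  have h5 := Submodule.add_mem _ (hWle h4)
    (Submodule.smul_mem _ (y 6) (LinearMap.mem_range_self (coneMap b P v) (1, 0)))
  simpa using h5

/-- A special twisted cubic whose points are those of the subline has the normal form. -/
theorem IsSpecialTwistedCubic.exists_isNormalForm (hv : v ≠ 0)
    (hθ : ∀ a : F, algebraMap F K a ≠ θ) (hl : HasAffineParam F l θ P v)
    {M : Matrix (Fin 7) (Fin 4) F} (hsp : IsSpecialTwistedCubic b M)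
    (hM : cubicPoints M = affineImage b l) :
    ∃ (η : K) (c : F) (m₁ m₂ : K) (z : Fin 4 → F) (k : Fin 4 → K),
      (∀ a : F, algebraMap F K a ≠ η) ∧ c ≠ 0 ∧ m₁ * η + m₂ ≠ 0 ∧
      IsNormalForm η c m₁ m₂ z k ∧ M = coneMatrix b P v z k := by
  have h3 := finrank_eq_three b
  obtain ⟨z, k, rfl⟩ := exists_eq_coneMatrix b P v M (hsp.range_le hv hθ hl hM)
  obtain ⟨hinj, -, -, htr⟩ := hsp
  have hz : ∀ s t : F, (s ≠ 0 ∨ t ≠ 0) → cubicPoint s t 0 * z 0 + cubicPoint s t 1 * z 1 +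
      cubicPoint s t 2 * z 2 + cubicPoint s t 3 * z 3 ≠ 0 := by
    intro s t hst
    obtain ⟨a, s', t', ha, -, h1⟩ := exists_mulVec_eq_of_cubicPoints hv hl hinj hM hst
    have h2 := congrFun h1 6
    rw [coneMatrix_mulVec, coneMap_six, coneMap_six] at h2
    simp only at h2
    rwa [h2]
  have hz0 : z 0 ≠ 0 := by simpa [cubicPoint] using hz 1 0 (by simp)
  -- One transversal is enough: conjugation supplies the remaining roots. The parameter s/t is a
  -- root of z, hence not in F, because all rational points of the cubic are affine.
  obtain ⟨s, t, hst, hmem⟩ := htr _ (isTransversal_transversal b 0)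
  rw [coneMatrix_map_mulVec_mem_transversal b P hv] at hmem
  obtain ⟨e1, e2⟩ := hmem
  simp only [cubicPoint, Matrix.cons_val] at e1 e2
  have ht : t ≠ 0 := by
    rintro rfl
    have hs : s ≠ 0 := by simpa using hst
    simp [hs, hz0] at e1
  have scale : ∀ x₀ x₁ x₂ x₃ : K, s ^ 3 * x₀ + s ^ 2 * t * x₁ + s * t ^ 2 * x₂ + t ^ 3 * x₃ = 0 →
      (s / t) ^ 3 * x₀ + (s / t) ^ 2 * x₁ + s / t * x₂ + x₃ = 0 := by
    intro x₀ x₁ x₂ x₃ h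
    field_simp
    linear_combination h
  have f1 := scale _ _ _ _ e1
  have hη : ∀ a : F, algebraMap F K a ≠ s / t := by
    intro a ha
    apply hz a 1 (by simp)
    apply (algebraMap F K).injective
    rw [← ha] at f1
    simp only [cubicPoint, Matrix.cons_val, map_add, map_mul, map_pow, map_one, map_zero]
    linear_combination f1
  obtain ⟨m₁, m₂, hN⟩ := BruckBose.exists_isNormalForm h3 hη f1
    (fun m hm => scale _ _ _ _ (e2 m hm))
  refine ⟨s / t, z 0, m₁, m₂, z, k, hη, hz0, ?_, hN, rfl⟩
  intro hΔ
  -- If m₁η + m₂ = 0, then m₁s + m₂t is m₁ times s - ηt and k is proportional to z. The vector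
  -- eliminates between the first two coefficients and contradicts rank 4.
  have h0 : coneMatrix b P v z k *ᵥ ![-z 1, z 0, 0, 0] = 0 := by
    rw [coneMatrix_mulVec]
    convert! map_zero (coneMap b P v)
    · simp; ring
    · simp only [Matrix.cons_val, map_neg, map_zero, hN.z_one, hN.k_zero, hN.k_one,
        Prod.snd_zero]
      linear_combination algebraMap F K (z 0) * hΔ
  have h1 := hinj (h0.trans (Matrix.mulVec_zero _).symm)
  exact hz0 (congrFun h1 1)

omit [Finite F] in
theorem coneMap_inf_ne_zero (b : Module.Basis (Fin 3) F K) (P : K × K) (hv : v ≠ 0)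
    (hθ : ∀ a : F, algebraMap F K a ≠ θ) {s t : F} (hst : s ≠ 0 ∨ t ≠ 0) :
    coneMap b P v (0, 1 / (algebraMap F K s - θ * algebraMap F K t) ^ 2) ≠ 0 :=
  coneMap_ne_zero b P hv (by simpa using sub_mul_ne_zero hθ hst)

theorem IsNormalForm.cubicPoint_smul {c : F} {m₁ m₂ : K} {z : Fin 4 → F} {k : Fin 4 → K}
    (h : IsNormalForm θ c m₁ m₂ z k) (hθ : ∀ a : F, algebraMap F K a ≠ θ) (hc : c ≠ 0)
    (b : Module.Basis (Fin 3) F K) (P v : K × K) {s t : F} (hst : s ≠ 0 ∨ t ≠ 0) :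
    ∃ a : F, a ≠ 0 ∧ coneMatrix b P v z k *ᵥ cubicPoint s t = a • coneMap b P v
      (1, (m₁ * algebraMap F K s + m₂ * algebraMap F K t) /
        (algebraMap F K c * (algebraMap F K s - θ * algebraMap F K t))) := by
  refine ⟨_, h.eval_z_ne_zero hθ hc hst, ?_⟩
  have hδ := sub_mul_ne_zero hθ hst
  have hc' : algebraMap F K c ≠ 0 := by simpa only [Ne, map_eq_zero] using hc
  rw [coneMatrix_mulVec, ← map_smul]
  congr 1
  ext
  · simp
  · simp only [Prod.smul_snd]
    simp only [Algebra.smul_def]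
    rw [h.eval_z, h.eval_k, mul_div_assoc', eq_div_iff (mul_ne_zero hc' hδ)]
    ring

/-- The special twisted cubic of the subline. -/
theorem exists_isSpecialTwistedCubic (b : Module.Basis (Fin 3) F K) (hv : v ≠ 0)
    (hθ : ∀ a : F, algebraMap F K a ≠ θ) (hl : HasAffineParam F l θ P v) :
    ∃ (z : Fin 4 → F) (k : Fin 4 → K), IsNormalForm θ 1 0 1 z k ∧
      IsSpecialTwistedCubic b (coneMatrix b P v z k) ∧
      cubicPoints (coneMatrix b P v z k) = affineImage b l := by
  have h3 := finrank_eq_three b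
  obtain ⟨a1, ha1⟩ := exists_algebraMap_eq_of_frob_eq (F := F)
    (x := -(θ + frob F K θ + frob F K (frob F K θ))) (by
      simp only [map_neg, map_add, frob_frob_frob h3]; ring)
  obtain ⟨a2, ha2⟩ := exists_algebraMap_eq_of_frob_eq (F := F)
    (x := θ * frob F K θ + θ * frob F K (frob F K θ) + frob F K θ * frob F K (frob F K θ)) (by
      simp only [map_mul, map_add, frob_frob_frob h3]; ring)
  obtain ⟨a3, ha3⟩ := exists_algebraMap_eq_of_frob_eq (F := F)
    (x := -(θ * frob F K θ * frob F K (frob F K θ))) (by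
      simp only [map_mul, map_neg, frob_frob_frob h3]; ring)
  -- The coefficients of N(s - θt) and of t(s - θ^q t)(s - θ^{q²}t).
  set z : Fin 4 → F := ![1, a1, a2, a3] with hz
  set k : Fin 4 → K := ![0, 1, -(frob F K θ + frob F K (frob F K θ)),
    frob F K θ * frob F K (frob F K θ)] with hk
  have hN : IsNormalForm θ 1 0 1 z k := by
    constructor <;> simp [hz, hk, ha1, ha2, ha3]
  have e1 := sub_ne_zero.mpr (frob_ne hθ).symm
  have e2 := sub_ne_zero.mpr (frob_frob_ne h3 hθ).symm
  have e3 := sub_ne_zero.mpr (frob_frob_ne_frob hθ).symm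
  -- the map `(z, k)` from `F⁴` to `F × K` is injective
  have hker : ∀ c : Fin 4 → F, coneMatrix b P v z k *ᵥ c = 0 → c = 0 := by
    intro c hc
    rw [coneMatrix_mulVec] at hc
    have h1 := coneMap_injective b P hv (hc.trans (map_zero _).symm)
    rw [Prod.mk_eq_zero] at h1
    obtain ⟨hz0, hk0⟩ := h1
    simp only [hz, hk, Matrix.cons_val] at hz0 hk0
    have hk1 := congrArg (frob F K) hk0
    have hk2 := congrArg (frob F K) hk1
    simp only [map_add, map_mul, map_neg, map_zero, map_one, frob_algebraMap,
      frob_frob_frob h3] at hk1 hk2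
    -- Divided differences of the three conjugate equations peel off the coefficients.
    have g1 : -algebraMap F K (c 2) + frob F K (frob F K θ) * algebraMap F K (c 3) = 0 :=
      (mul_eq_zero.mp (by linear_combination hk1 - hk0 : (θ - frob F K θ) *
        (-algebraMap F K (c 2) + frob F K (frob F K θ) * algebraMap F K (c 3)) = 0)).resolve_left e1
    have g2 : -algebraMap F K (c 2) + frob F K θ * algebraMap F K (c 3) = 0 :=
      (mul_eq_zero.mp (by linear_combination hk2 - hk0 : (θ - frob F K (frob F K θ)) *
        (-algebraMap F K (c 2) + frob F K θ * algebraMap F K (c 3)) = 0)).resolve_left e2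
    have g3 : algebraMap F K (c 3) = 0 :=
      (mul_eq_zero.mp (by linear_combination g2 - g1 : (frob F K θ - frob F K (frob F K θ)) *
        algebraMap F K (c 3) = 0)).resolve_left e3
    have g4 : algebraMap F K (c 2) = 0 := by
      linear_combination frob F K θ * g3 - g2
    have g5 : algebraMap F K (c 1) = 0 := by
      linear_combination hk0 + (frob F K θ + frob F K (frob F K θ)) * g4 -
        frob F K θ * frob F K (frob F K θ) * g3
    rw [map_eq_zero] at g3 g4 g5
    rw [g3, g4, g5] at hz0
    ext i
    fin_cases i
    · simpa using hz0
    · exact g5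
    · exact g4
    · exact g3
  have hinj : Function.Injective (coneMatrix b P v z k).mulVec := by
    have : Function.Injective (coneMatrix b P v z k).mulVecLin := by
      rw [← LinearMap.ker_eq_bot, LinearMap.ker_eq_bot']
      exact hker
    exact this
  have hrange : LinearMap.range (coneMatrix b P v z k).mulVecLin =
      LinearMap.range (coneMap b P v) := by
    have : Module.Finite F K := Module.Finite.of_basis b
    apply Submodule.eq_of_le_of_finrank_eq
    · rintro _ ⟨c, rfl⟩
      rw [Matrix.mulVecLin_apply, coneMatrix_mulVec]
      exact LinearMap.mem_range_self _ _
    · rw [LinearMap.finrank_range_of_inj hinj,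
        LinearMap.finrank_range_of_inj (coneMap_injective b P hv)]
      simp [h3]
  refine ⟨z, k, hN, ⟨hinj, ⟨_, ⟨Projectivization.mk K _ (vec_ne_zero hv),
    (mk_mem_lineAtInfinity _).2 rfl, rfl⟩, ?_⟩, ?_, ?_⟩, ?_⟩
  · intro x hx
    obtain ⟨κ, rfl⟩ := (mem_spreadElement_iff_coneMap b P hv x).1 hx
    rw [hrange]
    exact LinearMap.mem_range_self _ _
  · intro h
    rw [hrange] at h
    exact one_ne_zero (h (LinearMap.mem_range_self (coneMap b P v) (1, 0)))
  · intro g hg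
    obtain ⟨l, rfl⟩ := hg.exists_eq
    -- This conjugate of θ is a root of z and of both conjugates of k in the places other than l.
    refine ⟨frobPow F K l θ, 1, Or.inr one_ne_zero, ?_⟩
    rw [coneMatrix_map_mulVec_mem_transversal b P hv]
    simp only [hz, hk, cubicPoint, Matrix.cons_val, ha1, ha2, ha3]
    constructor
    · fin_cases l
      · simp; ring
      · simp; ring
      · simp; ring
    · intro m hm
      fin_cases l <;> fin_cases m <;>
        simp [frob_frob_frob h3] at hm ⊢ <;> ring
  · ext Q
    rw [mem_affineImage_iff b hv hl]
    constructor
    · rintro ⟨s, t, h0, rfl⟩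
      have hst : s ≠ 0 ∨ t ≠ 0 := by
        by_contra! h
        apply h0
        have hc0 : cubicPoint s t = 0 := by
          rw [h.1, h.2]
          ext i; fin_cases i <;> simp [cubicPoint]
        rw [hc0, Matrix.mulVec_zero]
      obtain ⟨a, ha, h⟩ := hN.cubicPoint_smul hθ one_ne_zero b P v hst
      refine ⟨s, t, hst, ?_⟩
      rw [Projectivization.mk_eq_mk_iff']
      refine ⟨a, ?_⟩
      rw [h]
      simp
    · rintro ⟨s, t, hst, rfl⟩
      obtain ⟨a, ha, h⟩ := hN.cubicPoint_smul hθ one_ne_zero b P v hst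
      refine ⟨s, t, fun h0 => cubicPoint_ne_zero hst (hker _ h0), ?_⟩
      rw [eq_comm, Projectivization.mk_eq_mk_iff']
      refine ⟨a, ?_⟩
      rw [h]
      simp

/-- For an arbitrary admissible cubic the tangent gives (m₁η + m₂)/(s - ηt)². Reparametrising
contributes μ² times an element of F to the numerator and μ² to the denominator, so only a scalar of
F remains. -/
theorem mem_shadow_iff (b : Module.Basis (Fin 3) F K) (hv : v ≠ 0)
    (hθ : ∀ a : F, algebraMap F K a ≠ θ) (hl : HasAffineParam F l θ P v)
    (D : ℙ F (Fin 7 → F)) :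
    D ∈ shadow b l ↔ ∃ (s t : F) (hst : s ≠ 0 ∨ t ≠ 0),
      D = Projectivization.mk F _ (coneMap_inf_ne_zero b P hv hθ hst) := by
  constructor
  · rintro ⟨M, hsp, hM, s, t, hst, h1, h2⟩
    obtain ⟨η, c, m₁, m₂, z, k, hη, hc, hΔ, hN, rfl⟩ := hsp.exists_isNormalForm hv hθ hl hM
    have hc' : algebraMap F K c ≠ 0 := by simpa only [Ne, map_eq_zero] using hc
    have hD := le_inf h1 h2
    rw [hN.tangentLine_inf hη hc b P v hst, submodule_le_span_singleton_iff D
      (coneMap_ne_zero b P hv (by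
        simpa using ⟨hΔ, sub_mul_ne_zero hη hst⟩))] at hD
    have hΔ' : m₁ / algebraMap F K c * η + m₂ / algebraMap F K c ≠ 0 := by
      rw [div_mul_eq_mul_div, ← add_div]
      exact div_ne_zero hΔ hc'
    obtain ⟨μ, a₁, a₂, c₁, c₂, hμ, hdet, hΔ2, hδ⟩ := exists_reparam hη hθ hΔ' (by
      intro x y hxy
      obtain ⟨a, x', y', ha, hxy', e⟩ := exists_mulVec_eq_of_cubicPoints hv hl hsp.1 hM hxy
      obtain ⟨a', ha', e'⟩ := hN.cubicPoint_smul hη hc b P v hxy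
      rw [e, ← map_smul] at e'
      have e2 := coneMap_injective b P hv e'
      have e3 := congrArg Prod.fst e2
      have e4 := congrArg Prod.snd e2
      simp only [Prod.smul_fst, Prod.smul_snd, smul_eq_mul, mul_one] at e3 e4
      rw [e3, Algebra.smul_def] at e4
      have ha2 : algebraMap F K a' ≠ 0 := by simpa only [Ne, map_eq_zero] using ha'
      have e5 := mul_left_cancel₀ ha2 e4
      rw [div_eq_div_iff (sub_mul_ne_zero hθ hxy')
        (mul_ne_zero hc' (sub_mul_ne_zero hη hxy))] at e5
      refine ⟨x', y', hxy', ?_⟩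
      field_simp
      linear_combination -e5)
    have hst' : a₁ * s + a₂ * t ≠ 0 ∨ c₁ * s + c₂ * t ≠ 0 := by
      by_contra! h
      have := sub_mul_ne_zero hη hst
      rw [hδ, h.1, h.2] at this
      simp at this
    refine ⟨a₁ * s + a₂ * t, c₁ * s + c₂ * t, hst', ?_⟩
    rw [hD, Projectivization.mk_eq_mk_iff']
    refine ⟨c * (a₁ * c₂ - a₂ * c₁), ?_⟩
    rw [← map_smul]
    congr 1
    ext
    · simp
    · simp only [Prod.smul_snd]
      rw [Algebra.smul_def, hδ s t]
      have h4 := sub_mul_ne_zero hθ hst'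
      have h5 : m₁ * η + m₂ =
          algebraMap F K c * (μ ^ 2 * algebraMap F K (a₁ * c₂ - a₂ * c₁)) := by
        rw [← hΔ2]
        field_simp
      rw [h5, map_mul, mul_pow, mul_one_div,
        div_eq_div_iff (pow_ne_zero 2 h4) (mul_ne_zero (pow_ne_zero 2 hμ) (pow_ne_zero 2 h4))]
      ring
  · rintro ⟨s, t, hst, rfl⟩
    obtain ⟨z, k, hN, hsp, hM⟩ := exists_isSpecialTwistedCubic b hv hθ hl
    refine ⟨_, hsp, hM, s, t, hst, ?_⟩
    rw [← le_inf_iff, hN.tangentLine_inf hθ one_ne_zero b P v hst, Projectivization.submodule_mk,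
      zero_mul, zero_add]

end Shadow

/-! ### Special conics -/

section QuadraticForms

variable {F K : Type*} [Field F] [Field K] [Algebra F K]

theorem exists_linear_of_isHomogeneous_one {p : MvPolynomial (Fin 7) F}
    (hp : p ∈ MvPolynomial.homogeneousSubmodule (Fin 7) F 1) :
    ∃ f : (Fin 7 → K) →ₗ[K] K, ∀ x, MvPolynomial.aeval x p = f x := by
  rw [MvPolynomial.homogeneousSubmodule_one_eq_span_X] at hp
  induction hp using Submodule.span_induction with
  | mem p hp =>
    obtain ⟨i, rfl⟩ := hp
    exact ⟨LinearMap.proj i, fun x => by simp⟩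
  | zero => exact ⟨0, fun x => by simp⟩
  | add p r _ _ hp hr =>
    obtain ⟨f, hf⟩ := hp
    obtain ⟨g, hg⟩ := hr
    exact ⟨f + g, fun x => by simp [hf, hg]⟩
  | smul a p _ hp =>
    obtain ⟨f, hf⟩ := hp
    exact ⟨algebraMap F K a • f, fun x => by simp [hf, Algebra.smul_def]⟩

/-- The bilinear form need not be symmetric, so nothing is halved and characteristic 2 is covered.
It serves to expand the polynomial on linear combinations. -/
theorem exists_bilin_of_isHomogeneous_two {p : MvPolynomial (Fin 7) F} (hp : p.IsHomogeneous 2) :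
    ∃ B : (Fin 7 → K) →ₗ[K] (Fin 7 → K) →ₗ[K] K, ∀ x, MvPolynomial.aeval x p = B x x := by
  have h : p ∈ MvPolynomial.homogeneousSubmodule (Fin 7) F 1 *
      MvPolynomial.homogeneousSubmodule (Fin 7) F 1 := by
    rw [← pow_two, MvPolynomial.homogeneousSubmodule_one_pow]
    exact hp
  clear hp
  induction h using Submodule.mul_induction_on' with
  | mem_mul_mem p hp r hr =>
    obtain ⟨f, hf⟩ := exists_linear_of_isHomogeneous_one (K := K) hp
    obtain ⟨g, hg⟩ := exists_linear_of_isHomogeneous_one (K := K) hr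
    exact ⟨f.smulRight g, fun x => by simp [hf, hg]⟩
  | add p _ r _ hp hr =>
    obtain ⟨f, hf⟩ := hp
    obtain ⟨g, hg⟩ := hr
    exact ⟨f + g, fun x => by simp [hf, hg]⟩

theorem aeval_embed (p : MvPolynomial (Fin 7) F) (y : Fin 7 → F) :
    MvPolynomial.aeval (embed F K y) p = algebraMap F K (p.eval y) := by
  have h := MvPolynomial.aeval_algebraMap_apply K y p
  exact h.trans (by rw [← MvPolynomial.coe_aeval_eq_eval]; rfl)

/-- The quadratic form with coefficients `c i j`. -/
noncomputable def quadPoly (c : Fin 7 → Fin 7 → F) : MvPolynomial (Fin 7) F :=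
  ∑ i, ∑ j, MvPolynomial.C (c i j) * (MvPolynomial.X i * MvPolynomial.X j)

theorem quadPoly_isHomogeneous (c : Fin 7 → Fin 7 → F) : (quadPoly c).IsHomogeneous 2 :=
  MvPolynomial.IsHomogeneous.sum _ _ _ fun i _ => MvPolynomial.IsHomogeneous.sum _ _ _ fun j _ =>
    ((MvPolynomial.isHomogeneous_X F i).mul (MvPolynomial.isHomogeneous_X F j)).C_mul (c i j)

theorem aeval_quadPoly (c : Fin 7 → Fin 7 → F) (x : Fin 7 → K) :
    MvPolynomial.aeval x (quadPoly c) = ∑ i, ∑ j, algebraMap F K (c i j) * (x i * x j) := by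
  simp [quadPoly, map_sum]

end QuadraticForms

/-! ### Quadratic forms on a spread element in conjugate coordinates -/

section Conics

variable {F K : Type*} [Field F] [Finite F] [Field K] [Algebra F K]

/-- The vector in which the `l`-th transversal meets the extension of `[v]`. -/
noncomputable def conjPoint (F : Type*) {K : Type*} [Field F] [Finite F] [Field K] [Algebra F K]
    (b : Module.Basis (Fin 3) F K) (v : K × K) (l : Fin 3) : Fin 7 → K :=
  transversalVec b l (frobPow F K l v.1, frobPow F K l v.2)

theorem conjPoint_ne_zero (b : Module.Basis (Fin 3) F K) {v : K × K} (hv : v ≠ 0) (l : Fin 3) :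
    conjPoint F b v l ≠ 0 := by
  intro h
  have h1 := transversalVec_injective b l (h.trans (map_zero _).symm)
  simp only [Prod.mk_eq_zero, map_eq_zero] at h1
  exact hv (Prod.ext h1.1 h1.2)

theorem embed_coneMap_inf (b : Module.Basis (Fin 3) F K) (P v : K × K) (κ : K) :
    embed F K (coneMap b P v (0, κ)) = κ • conjPoint F b v 0 + frob F K κ • conjPoint F b v 1 +
      frob F K (frob F K κ) • conjPoint F b v 2 := by
  apply eq_of_coord b
  · simp [conjPoint]
  · intro m
    rw [coordX_embed_coneMap]
    simp only [conjPoint, map_add, map_smul, coordX_transversalVec]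
    fin_cases m <;> simp
  · intro m
    rw [coordY_embed_coneMap]
    simp only [conjPoint, map_add, map_smul, coordY_transversalVec]
    fin_cases m <;> simp

/-- The dual basis inverts the expansion of rational vectors in the three conjugate points. -/
theorem conjPoint_mem_extend (b : Module.Basis (Fin 3) F K) (P : K × K) {v : K × K} (hv : v ≠ 0)
    (l : Fin 3) : conjPoint F b v l ∈
      extend K (spreadElement b (Projectivization.mk K _ (vec_ne_zero hv))) := by
  have h : conjPoint F b v l =
      frobPow F K l (dualElt b 0) • embed F K (coneMap b P v (0, b 0)) +
      frobPow F K l (dualElt b 1) • embed F K (coneMap b P v (0, b 1)) +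
      frobPow F K l (dualElt b 2) • embed F K (coneMap b P v (0, b 2)) := by
    apply eq_of_coord b
    · simp [conjPoint]
    · intro m
      simp only [conjPoint, map_add, map_smul, coordX_transversalVec, coordX_embed_coneMap,
        smul_eq_mul, map_zero, zero_mul, zero_add]
      have h1 := sum_frobPow_mul_dualElt b m l
      have h2 : (if m = l then frobPow F K l v.1 else 0) =
          (if m = l then 1 else 0) * frobPow F K m v.1 := by
        split_ifs with hm
        · rw [hm, one_mul]
        · rw [zero_mul]
      rw [h2, ← h1]
      ring
    · intro m
      simp only [conjPoint, map_add, map_smul, coordY_transversalVec, coordY_embed_coneMap,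
        smul_eq_mul, map_zero, zero_mul, zero_add]
      have h1 := sum_frobPow_mul_dualElt b m l
      have h2 : (if m = l then frobPow F K l v.2 else 0) =
          (if m = l then 1 else 0) * frobPow F K m v.2 := by
        split_ifs with hm
        · rw [hm, one_mul]
        · rw [zero_mul]
      rw [h2, ← h1]
      ring
  have hmem : ∀ κ, embed F K (coneMap b P v (0, κ)) ∈
      extend K (spreadElement b (Projectivization.mk K _ (vec_ne_zero hv))) := fun κ =>
    Submodule.subset_span ⟨_, (mem_spreadElement_iff_coneMap b P hv _).2 ⟨κ, rfl⟩, rfl⟩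
  rw [h]
  exact add_mem (add_mem (Submodule.smul_mem _ _ (hmem _)) (Submodule.smul_mem _ _ (hmem _)))
    (Submodule.smul_mem _ _ (hmem _))

/-- The extension of [v] is spanned by the three conjugate points, one on each transversal, and the
places other than l must vanish. -/
theorem exists_smul_conjPoint_of_mem (b : Module.Basis (Fin 3) F K) {v : K × K}
    (hv : v ≠ 0) {l : Fin 3} {x : Fin 7 → K} (hx : x ∈ transversal b l)
    (hxe : x ∈ extend K (spreadElement b (Projectivization.mk K _ (vec_ne_zero hv)))) :
    ∃ c : K, x = c • conjPoint F b v l := by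
  have hle : extend K (spreadElement b (Projectivization.mk K _ (vec_ne_zero hv))) ≤
      Submodule.span K {conjPoint F b v 0, conjPoint F b v 1, conjPoint F b v 2} := by
    rw [extend, Submodule.span_le]
    rintro _ ⟨y, hy, rfl⟩
    obtain ⟨κ, rfl⟩ := (mem_spreadElement_iff_coneMap b 0 hv y).1 hy
    rw [embed_coneMap_inf]
    exact Submodule.mem_span_triple.2 ⟨_, _, _, rfl⟩
  obtain ⟨c0, c1, c2, rfl⟩ := Submodule.mem_span_triple.1 (hle hxe)
  rw [mem_transversal_iff] at hx
  set c : Fin 3 → K := ![c0, c1, c2] with hc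
  have hzero : ∀ m, m ≠ l → c m = 0 := by
    intro m hm
    obtain ⟨h1, h2⟩ := hx.2 m hm
    simp only [conjPoint, map_add, map_smul, coordX_transversalVec, coordY_transversalVec,
      smul_eq_mul] at h1 h2
    have h1' : c m * frobPow F K m v.1 = 0 := by
      rw [← h1]; fin_cases m <;> simp [hc]
    have h2' : c m * frobPow F K m v.2 = 0 := by
      rw [← h2]; fin_cases m <;> simp [hc]
    by_contra h0
    have h4 := (mul_eq_zero.mp h1').resolve_left h0
    have h5 := (mul_eq_zero.mp h2').resolve_left h0
    rw [map_eq_zero] at h4 h5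
    exact hv (Prod.ext h4 h5)
  refine ⟨c l, ?_⟩
  fin_cases l
  · have e1 : c1 = 0 := hzero 1 (by decide)
    have e2 : c2 = 0 := hzero 2 (by decide)
    simp [hc, e1, e2]
  · have e1 : c0 = 0 := hzero 0 (by decide)
    have e2 : c2 = 0 := hzero 2 (by decide)
    simp [hc, e1, e2]
  · have e1 : c0 = 0 := hzero 0 (by decide)
    have e2 : c1 = 0 := hzero 1 (by decide)
    simp [hc, e1, e2]

/-- The quadratic forms on `[v]` whose extension vanishes on the transversals. -/
theorem exists_special_form (b : Module.Basis (Fin 3) F K) (P : K × K) {v : K × K} (hv : v ≠ 0)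
    {p : MvPolynomial (Fin 7) F} (hp : p.IsHomogeneous 2)
    (htr : ∀ g, IsTransversal b g → ∃ x ∈ g, x ≠ 0 ∧
      x ∈ extend K (spreadElement b (Projectivization.mk K _ (vec_ne_zero hv))) ∧
      p.aeval x = 0) :
    ∃ β₀ β₁ β₂ : K, ∀ κ, algebraMap F K (p.eval (coneMap b P v (0, κ))) =
      β₀ * (frob F K κ * frob F K (frob F K κ)) + β₁ * (κ * frob F K (frob F K κ)) +
        β₂ * (κ * frob F K κ) := by
  obtain ⟨B, hB⟩ := exists_bilin_of_isHomogeneous_two (K := K) hp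
  -- These are the coefficients of the squares of κ, κ^q and κ^{q²}; only mixed products survive.
  have hE : ∀ l, B (conjPoint F b v l) (conjPoint F b v l) = 0 := by
    intro l
    obtain ⟨x, hxg, hx0, hxe, hpx⟩ := htr _ (isTransversal_transversal b l)
    obtain ⟨c, rfl⟩ := exists_smul_conjPoint_of_mem b hv hxg hxe
    have hc : c ≠ 0 := by rintro rfl; simp at hx0
    rw [hB] at hpx
    simpa [hc] using hpx
  refine ⟨B (conjPoint F b v 1) (conjPoint F b v 2) + B (conjPoint F b v 2) (conjPoint F b v 1),
    B (conjPoint F b v 0) (conjPoint F b v 2) + B (conjPoint F b v 2) (conjPoint F b v 0),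
    B (conjPoint F b v 0) (conjPoint F b v 1) + B (conjPoint F b v 1) (conjPoint F b v 0), ?_⟩
  intro κ
  rw [← aeval_embed, hB, embed_coneMap_inf]
  simp only [map_add, map_smul, LinearMap.add_apply, LinearMap.smul_apply, smul_eq_mul]
  linear_combination κ ^ 2 * hE 0 + frob F K κ ^ 2 * hE 1 + frob F K (frob F K κ) ^ 2 * hE 2

/-- The quadratic form `Tr(β κ κ^q)` on `[v]`. -/
theorem exists_quadPoly (b : Module.Basis (Fin 3) F K) {v : K × K} (hv : v ≠ 0) (β : K) :
    ∃ p : MvPolynomial (Fin 7) F, p.IsHomogeneous 2 ∧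
      (∀ l, p.aeval (conjPoint F b v l) = 0) ∧
      ∀ P κ, algebraMap F K (p.eval (coneMap b P v (0, κ))) = β * (κ * frob F K κ) +
        frob F K β * (frob F K κ * frob F K (frob F K κ)) +
        frob F K (frob F K β) * (frob F K (frob F K κ) * κ) := by
  have h3 := finrank_eq_three b
  -- A functional that recovers κ from κv. Its conjugates `R m` are the coordinates dual to the
  -- conjugate points.
  obtain ⟨α₁, α₂, hα⟩ : ∃ α₁ α₂ : K, α₁ * v.1 + α₂ * v.2 = 1 := by
    by_cases h : v.1 = 0
    · have h2 : v.2 ≠ 0 := fun h2 => hv (Prod.ext h h2)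
      exact ⟨0, v.2⁻¹, by rw [inv_mul_cancel₀ h2]; ring⟩
    · exact ⟨v.1⁻¹, 0, by rw [inv_mul_cancel₀ h]; ring⟩
  let r : Fin 7 → K := ![α₁ * b 0, α₁ * b 1, α₁ * b 2, α₂ * b 0, α₂ * b 1, α₂ * b 2, 0]
  let R : Fin 3 → (Fin 7 → K) → K := fun m x => ∑ i, x i * frobPow F K m (r i)
  have hR : ∀ m x, R m x = frobPow F K m α₁ * coordX b m x + frobPow F K m α₂ * coordY b m x := by
    intro m x
    simp only [R, r, Fin.sum_univ_seven, coordX_apply, coordY_apply, Matrix.cons_val, map_mul,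
      map_zero]
    ring
  have hRE : ∀ m l, R m (conjPoint F b v l) = if m = l then 1 else 0 := by
    intro m l
    rw [hR, conjPoint, coordX_transversalVec, coordY_transversalVec]
    split_ifs with h
    · rw [h, ← map_mul, ← map_mul, ← map_add, hα, map_one]
    · ring
  let c : Fin 7 → Fin 7 → F := fun i j => Algebra.trace F K (β * (r i * frob F K (r j)))
  have hp : ∀ x : Fin 7 → K, MvPolynomial.aeval x (quadPoly c) = β * (R 0 x * R 1 x) +
      frob F K β * (R 1 x * R 2 x) + frob F K (frob F K β) * (R 2 x * R 0 x) := by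
    intro x
    rw [aeval_quadPoly]
    simp only [c, R, algebraMap_trace_eq h3, map_mul, frob_frob_frob h3, frobPow_zero,
      frobPow_one, frobPow_two]
    rw [Finset.sum_mul_sum, Finset.sum_mul_sum, Finset.sum_mul_sum]
    simp only [Finset.mul_sum, ← Finset.sum_add_distrib]
    refine Finset.sum_congr rfl fun i _ => Finset.sum_congr rfl fun j _ => ?_
    ring
  refine ⟨quadPoly c, quadPoly_isHomogeneous c, ?_, ?_⟩
  · intro l
    rw [hp, hRE, hRE, hRE]
    fin_cases l <;> simp
  · intro P κ
    have hRκ : ∀ m, R m (embed F K (coneMap b P v (0, κ))) = frobPow F K m κ := by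
      intro m
      rw [hR, coordX_embed_coneMap, coordY_embed_coneMap]
      have := congrArg (frobPow F K m) hα
      simp only [map_add, map_mul, map_one] at this
      simp only [map_zero, zero_mul, zero_add]
      linear_combination frobPow F K m κ * this
    rw [← aeval_embed, hp, hRκ, hRκ, hRκ, frobPow_zero, frobPow_one, frobPow_two]

/-- At a singular point all three coefficients of the polar form vanish. The one at y^q turns the
equation of the conic into the vanishing of a single product, so κ = 0. In characteristic 2 the
polar form alone would not do, as it has a radical on a plane. -/
theorem isNondegenerateOn_of_trace_form (b : Module.Basis (Fin 3) F K) (P : K × K) {v : K × K}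
    (hv : v ≠ 0) {β : K} (hβ : β ≠ 0) {p : MvPolynomial (Fin 7) F} (hp : p.IsHomogeneous 2)
    (hpe : ∀ κ, algebraMap F K (p.eval (coneMap b P v (0, κ))) = β * (κ * frob F K κ) +
        frob F K β * (frob F K κ * frob F K (frob F K κ)) +
        frob F K (frob F K β) * (frob F K (frob F K κ) * κ)) :
    IsNondegenerateOn p (spreadElement b (Projectivization.mk K _ (vec_ne_zero hv))) := by
  have h3 := finrank_eq_three b
  refine ⟨hp, ?_⟩
  intro x hx hx0 hsing
  obtain ⟨κ, rfl⟩ := (mem_spreadElement_iff_coneMap b P hv x).1 hx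
  have hpol : ∀ y : K, (β * frob F K κ + frob F K (frob F K β) * frob F K (frob F K κ)) * y +
      (β * κ + frob F K β * frob F K (frob F K κ)) * frob F K y +
      (frob F K β * frob F K κ + frob F K (frob F K β) * κ) * frob F K (frob F K y) = 0 := by
    intro y
    have h1 := hsing (coneMap b P v (0, y)) ((mem_spreadElement_iff_coneMap b P hv _).2 ⟨y, rfl⟩)
    rw [← map_add, Prod.mk_add_mk, add_zero] at h1
    have h2 := congrArg (algebraMap F K) h1
    rw [map_add, hpe, hpe, hpe] at h2
    simp only [map_add] at h2
    linear_combination h2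
  obtain ⟨θ, hθ⟩ := exists_notMem_range_algebraMap h3
  have e0 := hpol 1
  have e1 := hpol θ
  have e2 := hpol (θ ^ 2)
  simp only [map_one, mul_one, map_pow] at e0 e1 e2
  obtain ⟨-, f1, -⟩ := eq_zero_of_conjugates h3 hθ e0 e1 e2
  have h1 := hpe κ
  rw [hx0, map_zero] at h1
  have h2 : frob F K (frob F K β) * (frob F K (frob F K κ) * κ) = 0 := by
    linear_combination -h1 - frob F K κ * f1
  simp only [mul_eq_zero, map_eq_zero, hβ, false_or, or_self] at h2
  rw [h2]
  exact map_zero _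

end Conics

/-! ### The shadow as a point set, and its position relative to special conics -/

section ShadowGeometry

variable {F K : Type*} [Field F] [Finite F] [Field K] [Algebra F K]
variable {b : Module.Basis (Fin 3) F K} {l : Set (ℙ K (Fin 3 → K))} {θ : K} {P v : K × K}

/-- The shadow point with parameter `(s,t)`. -/
noncomputable def shadowPoint (b : Module.Basis (Fin 3) F K) (P : K × K) (hv : v ≠ 0)
    (hθ : ∀ a : F, algebraMap F K a ≠ θ) {s t : F} (hst : s ≠ 0 ∨ t ≠ 0) : ℙ F (Fin 7 → F) :=
  Projectivization.mk F _ (coneMap_inf_ne_zero b P hv hθ hst)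

omit [Finite F] in
theorem mk_coneMap_inf_eq_iff (b : Module.Basis (Fin 3) F K) (P : K × K) (hv : v ≠ 0) {κ κ' : K}
    (h : coneMap b P v (0, κ) ≠ 0) (h' : coneMap b P v (0, κ') ≠ 0) :
    Projectivization.mk F _ h = Projectivization.mk F _ h' ↔
      ∃ a : F, algebraMap F K a * κ' = κ := by
  rw [Projectivization.mk_eq_mk_iff']
  refine exists_congr fun a => ?_
  rw [← map_smul, (coneMap_injective b P hv).eq_iff]
  simp [Algebra.smul_def]

/-- Distinct points of `PG(1,q)` give distinct shadow points. -/
theorem shadowPoint_eq_iff (hv : v ≠ 0) (hθ : ∀ a : F, algebraMap F K a ≠ θ)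
    {s t s' t' : F} (hst : s ≠ 0 ∨ t ≠ 0) (hst' : s' ≠ 0 ∨ t' ≠ 0) :
    shadowPoint b P hv hθ hst = shadowPoint b P hv hθ hst' ↔ s * t' = s' * t := by
  have h3 := finrank_eq_three b
  have hδ := sub_mul_ne_zero hθ hst
  have hδ' := sub_mul_ne_zero hθ hst'
  rw [shadowPoint, shadowPoint, mk_coneMap_inf_eq_iff b P hv]
  constructor
  · rintro ⟨a, ha⟩
    rw [mul_one_div, div_eq_div_iff (pow_ne_zero 2 hδ') (pow_ne_zero 2 hδ), one_mul] at ha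
    -- Proportionality puts the square of δ'/δ in F, hence δ'/δ itself.
    obtain ⟨w, hw⟩ := exists_algebraMap_eq_of_frob_eq (frob_eq_of_sq (F := F) h3
      (w := (algebraMap F K s' - θ * algebraMap F K t') /
        (algebraMap F K s - θ * algebraMap F K t)) (by
        rw [div_pow, ← ha, mul_div_assoc, div_self (pow_ne_zero 2 hδ), mul_one,
          frob_algebraMap]))
    rw [eq_div_iff hδ] at hw
    have h1 : algebraMap F K (s' - w * s) - θ * algebraMap F K (t' - w * t) = 0 := by
      simp only [map_sub, map_mul]
      linear_combination -hw
    have h2 : ¬ (s' - w * s ≠ 0 ∨ t' - w * t ≠ 0) := fun h => sub_mul_ne_zero hθ h h1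
    push Not at h2
    linear_combination s * h2.2 - t * h2.1
  · intro h
    obtain ⟨w, hs, ht⟩ : ∃ w : F, s' = w * s ∧ t' = w * t := by
      rcases hst with h0 | h0
      · exact ⟨s' / s, by field_simp, by field_simp; linear_combination h⟩
      · exact ⟨t' / t, by field_simp; linear_combination -h, by field_simp⟩
    refine ⟨w ^ 2, ?_⟩
    rw [mul_one_div, div_eq_div_iff (pow_ne_zero 2 hδ') (pow_ne_zero 2 hδ), hs, ht]
    simp only [map_mul, map_pow]
    ring

theorem mem_shadow_iff_shadowPoint (hv : v ≠ 0) (hθ : ∀ a : F, algebraMap F K a ≠ θ)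
    (hl : HasAffineParam F l θ P v) (D : ℙ F (Fin 7 → F)) :
    D ∈ shadow b l ↔ ∃ (s t : F) (hst : s ≠ 0 ∨ t ≠ 0), D = shadowPoint b P hv hθ hst :=
  mem_shadow_iff b hv hθ hl D

theorem ncard_shadow (hv : v ≠ 0) (hθ : ∀ a : F, algebraMap F K a ≠ θ)
    (hl : HasAffineParam F l θ P v) : (shadow b l).ncard = Nat.card F + 1 := by
  have hrep : ∀ X : ℙ F (Fin 2 → F), X.rep 0 ≠ 0 ∨ X.rep 1 ≠ 0 := by
    intro X
    by_contra! h
    apply X.rep_nonzero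
    ext i; fin_cases i
    · exact h.1
    · exact h.2
  let f : ℙ F (Fin 2 → F) → ℙ F (Fin 7 → F) := fun X => shadowPoint b P hv hθ (hrep X)
  have hprop : ∀ (X : ℙ F (Fin 2 → F)) (u : Fin 2 → F) (hu : u ≠ 0),
      X.rep 0 * u 1 = u 0 * X.rep 1 → X = Projectivization.mk F u hu := by
    intro X u hu h
    rw [← X.mk_rep, eq_comm, Projectivization.mk_eq_mk_iff']
    rcases hrep X with h0 | h0
    · refine ⟨u 0 / X.rep 0, ?_⟩
      ext i; fin_cases i
      · simp [h0]
      · simp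
        field_simp
        linear_combination -h
    · refine ⟨u 1 / X.rep 1, ?_⟩
      ext i; fin_cases i
      · simp
        field_simp
        linear_combination h
      · simp [h0]
  have hf : Function.Injective f := by
    intro X Y h
    rw [shadowPoint_eq_iff] at h
    rw [hprop X Y.rep Y.rep_nonzero h, Y.mk_rep]
  have hrange : shadow b l = Set.range f := by
    ext D
    rw [mem_shadow_iff_shadowPoint hv hθ hl]
    constructor
    · rintro ⟨s, t, hst, rfl⟩
      have hu : ![s, t] ≠ 0 := by
        intro h
        have h0 := congrFun h 0
        have h1 := congrFun h 1
        simp at h0 h1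
        simp [h0, h1] at hst
      refine ⟨Projectivization.mk F ![s, t] hu, ?_⟩
      rw [shadowPoint_eq_iff]
      obtain ⟨a, ha⟩ := Projectivization.exists_smul_eq_mk_rep F ![s, t] hu
      rw [← ha]
      simp [Units.smul_def]
      ring
    · rintro ⟨X, rfl⟩
      exact ⟨_, _, hrep X, rfl⟩
  rw [hrange, ← Set.image_univ, Set.ncard_image_of_injective _ hf, Set.ncard_univ,
    Projectivization.card_of_finrank_two F _ (by simp)]

omit [Finite F] in
theorem shadowPoint_submodule_le (hv : v ≠ 0) (hθ : ∀ a : F, algebraMap F K a ≠ θ)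
    {s t : F} (hst : s ≠ 0 ∨ t ≠ 0) : (shadowPoint b P hv hθ hst).submodule ≤
      spreadElement b (Projectivization.mk K _ (vec_ne_zero hv)) := by
  rw [shadowPoint, Projectivization.submodule_mk, Submodule.span_singleton_le_iff_mem,
    mem_spreadElement_iff_coneMap b P hv]
  exact ⟨_, rfl⟩

omit [Finite F] in
theorem mk_mem_zeroLocus_iff {p : MvPolynomial (Fin 7) F} (hp : p.IsHomogeneous 2)
    (W : Submodule F (Fin 7 → F)) {w : Fin 7 → F} (hw : w ≠ 0) :
    Projectivization.mk F w hw ∈ zeroLocus p W ↔ w ∈ W ∧ p.eval w = 0 := by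
  simp only [zeroLocus, Set.mem_ofPred_eq, Projectivization.submodule_mk,
    Submodule.span_singleton_le_iff_mem, Submodule.mem_span_singleton]
  refine and_congr_right fun _ => ⟨fun h => h w ⟨1, one_smul _ _⟩, ?_⟩
  rintro h _ ⟨a, rfl⟩
  obtain ⟨B, hB⟩ := exists_bilin_of_isHomogeneous_two (K := F) hp
  have hB' : ∀ x, p.eval x = B x x := fun x => by
    rw [← hB, ← MvPolynomial.coe_aeval_eq_eval]; rfl
  rw [hB'] at h ⊢
  simp [h]

/-- In even characteristic the shadow is a special conic. -/
theorem isSpecialConic_shadow (hv : v ≠ 0) (hθ : ∀ a : F, algebraMap F K a ≠ θ)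
    (hl : HasAffineParam F l θ P v) (h2 : ringChar K = 2) :
    IsSpecialConic b (Projectivization.mk K _ (vec_ne_zero hv)) (shadow b l) := by
  have h3 := finrank_eq_three b
  have : Module.Finite F K := Module.Finite.of_basis b
  have : Finite K := Module.finite_of_finite F
  have htwo : (2 : K) = 0 := by
    have := ringChar.Nat.cast_ringChar (R := K)
    rw [h2] at this
    exact_mod_cast this
  set γ := frob F K θ - frob F K (frob F K θ) with hγ
  have hγ0 : γ ≠ 0 := sub_ne_zero.mpr (frob_frob_ne_frob hθ).symm
  -- The twist by φ² matches the conjugates: at κ = y⁻² the form Tr(βκκ^q) with β = φ²(γ²) equals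
  -- Tr(γ²y²)/N(y)², which is (Tr(γy)/N(y))² in characteristic 2.
  obtain ⟨p, hp, hpE, hpe⟩ := exists_quadPoly b hv (frob F K (frob F K (γ ^ 2)))
  have hβ : frob F K (frob F K (γ ^ 2)) ≠ 0 := by
    simpa only [Ne, map_eq_zero] using pow_ne_zero 2 hγ0
  refine ⟨p, isNondegenerateOn_of_trace_form b P hv hβ hp (hpe P), ?_, ?_⟩
  · have hzero : ∀ y : K, y ≠ 0 → (p.eval (coneMap b P v (0, 1 / y ^ 2)) = 0 ↔
        ∃ s t : F, y = algebraMap F K s - θ * algebraMap F K t) := by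
      intro y hy
      have hy1 : frob F K y ≠ 0 := by simpa only [Ne, map_eq_zero] using hy
      have hy2 : frob F K (frob F K y) ≠ 0 := by simpa only [Ne, map_eq_zero] using hy1
      have e : algebraMap F K (p.eval (coneMap b P v (0, 1 / y ^ 2))) =
          ((y * γ + frob F K y * frob F K γ + frob F K (frob F K y) * frob F K (frob F K γ)) /
            (y * frob F K y * frob F K (frob F K y))) ^ 2 := by
        rw [hpe P]
        simp only [map_div₀, map_pow, map_one, frob_frob_frob h3]
        field_simp
        linear_combination -(y * γ * frob F K y * frob F K γ +
          y * γ * frob F K (frob F K y) * frob F K (frob F K γ) +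
          frob F K y * frob F K γ * frob F K (frob F K y) * frob F K (frob F K γ)) * htwo
      rw [← map_eq_zero (algebraMap F K), e, pow_eq_zero_iff (by norm_num), div_eq_zero_iff,
        or_iff_left (mul_ne_zero (mul_ne_zero hy hy1) hy2)]
      simp only [hγ, map_sub, frob_frob_frob h3]
      constructor
      · exact fun h => exists_eq_of_trace_eq_zero hθ h
      · rintro ⟨s, t, rfl⟩
        simp only [frob_sub_mul]
        ring
    ext D
    rw [mem_shadow_iff_shadowPoint hv hθ hl]
    constructor
    · rintro ⟨s, t, hst, rfl⟩
      rw [shadowPoint, mk_mem_zeroLocus_iff hp]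
      exact ⟨(mem_spreadElement_iff_coneMap b P hv _).2 ⟨_, rfl⟩,
        (hzero _ (sub_mul_ne_zero hθ hst)).2 ⟨s, t, rfl⟩⟩
    · intro hD
      induction D using Projectivization.ind with
      | h w hw =>
        rw [mk_mem_zeroLocus_iff hp, mem_spreadElement_iff_coneMap b P hv] at hD
        obtain ⟨⟨κ, rfl⟩, h0⟩ := hD
        have hκ : κ ≠ 0 := by rintro rfl; exact hw (map_zero _)
        -- Every κ is a square here, so every point of the conic has the form y⁻² covered by
        -- `hzero`.
        obtain ⟨u, rfl⟩ := FiniteField.isSquare_of_char_two h2 κ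
        have hu : u ≠ 0 := left_ne_zero_of_mul hκ
        have hform : u * u = 1 / u⁻¹ ^ 2 := by
          rw [inv_pow, one_div, inv_inv, pow_two]
        obtain ⟨s, t, h1⟩ := (hzero u⁻¹ (inv_ne_zero hu)).1 (by rw [← hform]; exact h0)
        have hst : s ≠ 0 ∨ t ≠ 0 := by
          by_contra! h
          rw [h.1, h.2] at h1
          simp [hu] at h1
        refine ⟨s, t, hst, ?_⟩
        rw [shadowPoint, mk_coneMap_inf_eq_iff b P hv]
        exact ⟨1, by rw [hform, h1, map_one, one_mul]⟩
  · intro g hg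
    obtain ⟨m, rfl⟩ := hg.exists_eq
    exact ⟨conjPoint F b v m, ⟨_, rfl⟩, conjPoint_ne_zero b hv m, conjPoint_mem_extend b P hv m,
      hpE m⟩

/-- In odd characteristic a special conic has at most two points in common with the shadow. -/
theorem notMem_specialConic (hv : v ≠ 0) (hθ : ∀ a : F, algebraMap F K a ≠ θ)
    (h2 : (2 : K) ≠ 0) {C : Set (ℙ F (Fin 7 → F))}
    (hC : IsSpecialConic b (Projectivization.mk K _ (vec_ne_zero hv)) C)
    {s₁ t₁ s₂ t₂ s₃ t₃ : F} (h₁ : s₁ ≠ 0 ∨ t₁ ≠ 0) (h₂ : s₂ ≠ 0 ∨ t₂ ≠ 0) (h₃ : s₃ ≠ 0 ∨ t₃ ≠ 0)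
    (h12 : shadowPoint b P hv hθ h₁ ≠ shadowPoint b P hv hθ h₂)
    (h13 : shadowPoint b P hv hθ h₁ ≠ shadowPoint b P hv hθ h₃)
    (h23 : shadowPoint b P hv hθ h₂ ≠ shadowPoint b P hv hθ h₃) :
    ¬ (shadowPoint b P hv hθ h₁ ∈ C ∧ shadowPoint b P hv hθ h₂ ∈ C ∧
      shadowPoint b P hv hθ h₃ ∈ C) := by
  have h3 := finrank_eq_three b
  obtain ⟨p, ⟨hp, hnd⟩, rfl, htr⟩ := hC
  rintro ⟨m1, m2, m3⟩
  rw [Ne, shadowPoint_eq_iff] at h12 h13 h23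
  obtain ⟨β₀, β₁, β₂, hβ⟩ := exists_special_form b P hv hp htr
  let Λ : K → K := fun y => β₀ * y + β₁ * frob F K y + β₂ * frob F K (frob F K y)
  -- Multiplying the form at κ = δ⁻² by N(δ)² makes it linear in δ².
  have hΛ : ∀ {s t : F} (hst : s ≠ 0 ∨ t ≠ 0),
      shadowPoint b P hv hθ hst ∈
        zeroLocus p (spreadElement b (Projectivization.mk K _ (vec_ne_zero hv))) →
      Λ ((algebraMap F K s - θ * algebraMap F K t) ^ 2) = 0 := by
    intro s t hst h
    rw [shadowPoint, mk_mem_zeroLocus_iff hp] at h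
    have h1 := hβ (1 / (algebraMap F K s - θ * algebraMap F K t) ^ 2)
    rw [h.2, map_zero] at h1
    have hδ := sub_mul_ne_zero hθ hst
    generalize algebraMap F K s - θ * algebraMap F K t = δ at h1 hδ ⊢
    have hδ1 : frob F K δ ≠ 0 := by simpa only [Ne, map_eq_zero] using hδ
    have hδ2 : frob F K (frob F K δ) ≠ 0 := by simpa only [Ne, map_eq_zero] using hδ1
    simp only [map_div₀, map_pow, map_one] at h1
    field_simp at h1
    simp only [Λ, map_pow]
    linear_combination -h1
  have L1 := hΛ h₁ m1
  have L2 := hΛ h₂ m2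
  have L3 := hΛ h₃ m3
  have hδ₁ := sub_mul_ne_zero hθ h₁
  have hD : algebraMap F K (s₁ * t₂ - s₂ * t₁) ≠ 0 := by
    simpa only [Ne, map_eq_zero, sub_eq_zero] using h12
  have hx : algebraMap F K (s₃ * t₂ - s₂ * t₃) ≠ 0 :=
    (map_ne_zero _).2 (sub_ne_zero.2 (Ne.symm h23))
  have hy : algebraMap F K (s₁ * t₃ - s₃ * t₁) ≠ 0 := by
    simpa only [Ne, map_eq_zero, sub_eq_zero] using h13
  -- The Plücker relation between three vectors of a 2-dimensional F-space; its coefficients are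
  -- nonzero because the points are distinct.
  have hrel : algebraMap F K (s₁ * t₂ - s₂ * t₁) * (algebraMap F K s₃ - θ * algebraMap F K t₃) =
      algebraMap F K (s₃ * t₂ - s₂ * t₃) * (algebraMap F K s₁ - θ * algebraMap F K t₁) +
      algebraMap F K (s₁ * t₃ - s₃ * t₁) * (algebraMap F K s₂ - θ * algebraMap F K t₂) := by
    simp only [map_sub, map_mul]
    ring
  have hη : ∀ a : F, algebraMap F K a ≠ (algebraMap F K s₂ - θ * algebraMap F K t₂) /
      (algebraMap F K s₁ - θ * algebraMap F K t₁) := by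
    intro a ha
    rw [eq_div_iff hδ₁] at ha
    have h1 : algebraMap F K (s₂ - a * s₁) - θ * algebraMap F K (t₂ - a * t₁) = 0 := by
      simp only [map_sub, map_mul]
      linear_combination -ha
    have h4 : ¬ (s₂ - a * s₁ ≠ 0 ∨ t₂ - a * t₁ ≠ 0) := fun h => sub_mul_ne_zero hθ h h1
    push Not at h4
    exact h12 (by linear_combination s₁ * h4.2 - t₁ * h4.1)
  generalize algebraMap F K s₁ - θ * algebraMap F K t₁ = δ₁ at *
  generalize algebraMap F K s₂ - θ * algebraMap F K t₂ = δ₂ at *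
  generalize algebraMap F K s₃ - θ * algebraMap F K t₃ = δ₃ at *
  generalize s₁ * t₂ - s₂ * t₁ = d at *
  generalize s₃ * t₂ - s₂ * t₃ = x at *
  generalize s₁ * t₃ - s₃ * t₁ = y at *
  have hrel1 := congrArg (frob F K) hrel
  have hrel2 := congrArg (frob F K) hrel1
  simp only [map_add, map_mul, frob_algebraMap] at hrel1 hrel2
  simp only [Λ, map_pow] at L1 L2 L3
  -- Squaring the relation and applying Λ leaves the cross term 2xyΛ(δ₁δ₂); odd characteristic
  -- enters only here.
  have L12 : β₀ * (δ₁ * δ₂) + β₁ * (frob F K δ₁ * frob F K δ₂) +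
      β₂ * (frob F K (frob F K δ₁) * frob F K (frob F K δ₂)) = 0 := by
    have h5 : (2 * algebraMap F K x * algebraMap F K y) * (β₀ * (δ₁ * δ₂) +
        β₁ * (frob F K δ₁ * frob F K δ₂) +
        β₂ * (frob F K (frob F K δ₁) * frob F K (frob F K δ₂))) = 0 := by
      linear_combination algebraMap F K d ^ 2 * L3 - algebraMap F K x ^ 2 * L1 -
        algebraMap F K y ^ 2 * L2 -
        β₀ * (algebraMap F K d * δ₃ + algebraMap F K x * δ₁ + algebraMap F K y * δ₂) * hrel -
        β₁ * (algebraMap F K d * frob F K δ₃ + algebraMap F K x * frob F K δ₁ +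
          algebraMap F K y * frob F K δ₂) * hrel1 -
        β₂ * (algebraMap F K d * frob F K (frob F K δ₃) +
          algebraMap F K x * frob F K (frob F K δ₁) +
          algebraMap F K y * frob F K (frob F K δ₂)) * hrel2
    exact (mul_eq_zero.mp h5).resolve_left (mul_ne_zero (mul_ne_zero h2 hx) hy)
  have hδ₁1 : frob F K δ₁ ≠ 0 := by simpa only [Ne, map_eq_zero] using hδ₁
  have hδ₁2 : frob F K (frob F K δ₁) ≠ 0 := by simpa only [Ne, map_eq_zero] using hδ₁1
  -- Vandermonde for the ratio δ₂/δ₁: Λ vanishes at δ₁² times 1, the ratio and its square.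
  obtain ⟨e0, e1, e2⟩ := eq_zero_of_conjugates h3 hη L1 (by
    simp only [map_div₀]
    field_simp
    linear_combination L12) (by
    simp only [map_div₀]
    field_simp
    linear_combination L2)
  have g0 := (mul_eq_zero.mp e0).resolve_right (pow_ne_zero 2 hδ₁)
  have g1 := (mul_eq_zero.mp e1).resolve_right (pow_ne_zero 2 hδ₁1)
  have g2 := (mul_eq_zero.mp e2).resolve_right (pow_ne_zero 2 hδ₁2)
  have hvanish : ∀ w ∈ spreadElement b (Projectivization.mk K _ (vec_ne_zero hv)),
      p.eval w = 0 := by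
    intro w hw
    obtain ⟨κ, rfl⟩ := (mem_spreadElement_iff_coneMap b P hv w).1 hw
    rw [← map_eq_zero (algebraMap F K), hβ, g0, g1, g2]
    ring
  have h1mem : coneMap b P v (0, 1) ∈ spreadElement b (Projectivization.mk K _ (vec_ne_zero hv)) :=
    (mem_spreadElement_iff_coneMap b P hv _).2 ⟨1, rfl⟩
  -- The form is identically zero on the plane, so any nonzero vector of it is a forbidden singular
  -- point.
  refine coneMap_ne_zero b P hv (p := (0, 1)) (by simp) (hnd _ h1mem (hvanish _ h1mem) ?_)
  intro y hy
  rw [hvanish _ (add_mem h1mem hy), hvanish _ h1mem, hvanish _ hy, add_zero]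

end ShadowGeometry

end BruckBose

theorem lemma5p2 {F K : Type*} [Field F] [Finite F] [Field K] [Algebra F K]
    (b : Module.Basis (Fin 3) F K)
    (l : Set (ℙ K (Fin 3 → K))) (hl : BruckBose.IsSubline F l)
    (hdisj : Disjoint l (BruckBose.lineAtInfinity K))
    (L : ℙ K (Fin 3 → K)) (hL : L ∈ BruckBose.lineAtInfinity K)
    (hLl : L ∈ Projectivization.Subspace.span l) :
    ((∀ D ∈ BruckBose.shadow b l, D.submodule ≤ BruckBose.spreadElement b L) ∧
      (BruckBose.shadow b l).ncard = Nat.card F + 1) ∧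
    (Even (Nat.card F) → BruckBose.IsSpecialConic b L (BruckBose.shadow b l)) ∧
    (Odd (Nat.card F) → ∀ C, BruckBose.IsSpecialConic b L C →
      ∀ P ∈ BruckBose.shadow b l, ∀ Q ∈ BruckBose.shadow b l, ∀ R ∈ BruckBose.shadow b l,
        P ≠ Q → P ≠ R → Q ≠ R → ¬ (P ∈ C ∧ Q ∈ C ∧ R ∈ C)) := by
  obtain ⟨θ, A, v, hv, hθ, hparam, rfl⟩ := hl.exists_hasAffineParam hdisj hL hLl
  have hmem := BruckBose.mem_shadow_iff_shadowPoint (b := b) hv hθ hparam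
  let _ := Fintype.ofFinite F
  have hchar : ringChar F = 2 ↔ Even (Nat.card F) := by
    rw [FiniteField.even_card_iff_char_two, Nat.card_eq_fintype_card, Nat.even_iff]
  have hcharK : ringChar K = ringChar F := (Algebra.ringChar_eq F K).symm
  refine ⟨⟨?_, BruckBose.ncard_shadow hv hθ hparam⟩, ?_, ?_⟩
  · intro D hD
    obtain ⟨s, t, hst, rfl⟩ := (hmem D).1 hD
    exact BruckBose.shadowPoint_submodule_le hv hθ hst
  · intro heven
    exact BruckBose.isSpecialConic_shadow hv hθ hparam (hcharK.trans (hchar.2 heven))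
  · intro hodd C hC P hP Q hQ R hR hPQ hPR hQR
    obtain ⟨s₁, t₁, h₁, rfl⟩ := (hmem P).1 hP
    obtain ⟨s₂, t₂, h₂, rfl⟩ := (hmem Q).1 hQ
    obtain ⟨s₃, t₃, h₃, rfl⟩ := (hmem R).1 hR
    have htwo : (2 : K) ≠ 0 := Ring.two_ne_zero (fun h =>
      Nat.not_even_iff_odd.2 hodd (hchar.1 (hcharK.symm.trans h)))
    exact BruckBose.notMem_specialConic hv hθ htwo hC h₁ h₂ h₃ hPQ hPR hQR
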